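/- Let $n\ge 3$. A score sheet of $n$ teams is a family $S=(g_{ij})_{1\le i\ne j\le n}$ of nonnegative integers; put $g_i=\sum_{j\ne i} g_{ij}$. It is *runner-up consistent* if $g_1\ge g_2\ge\dots\ge g_n$ and $\bar g_2\ge \bar g_3\ge\dots\ge\bar g_n$, where $\bar g_i=\sum_{j\ne i,\,j\ne 1} g_{ij}$. Let $\mathscr R_n\subset\mathbb Z^{n(n-1)}$ be the monoid of all runner-up consistent score sheets, let $\mathbb R_+\mathscr R_n\subset\mathbb R^{n(n-1)}$ be the cone that it generates, and let $$\mathscr P_n=\mathbb R_+\mathscr R_n\cap\{x\in\mathbb R^{n(n-1)} : g_1(x)=1\},\qquad g_1(x)=\sum_{j\neq 1}x_{1j}.$$ Let $p_1,\dots,p_N$ be pairwise distinct lattice points whose convex hull is $\mathscr P_n$ (for instance all vertices, or all lattice points, of $\mathscr P_n$, in any order). The *pulling triangulation* of a nonempty face $F$ of $\mathscr P_n$ with respect to this order is defined recursively: a face that is a single point is its own triangulation; otherwise let $p$ be the first point of the sequence that lies in $F$; the maximal simplices are the sets $\operatorname{conv}(\{p\}\cup\sigma)$, where $\sigma$ runs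 through the maximal simplices of the pulling triangulations of the facets of $F$ that do not contain $p$. Then: 1. Every pulling triangulation of $\mathscr P_n$ is a unimodular triangulation of $\mathscr P_n$: its maximal simplices are lattice simplices that cover $\mathscr P_n$, any two of them meet in the (possibly empty) common face spanned by their common vertices, and for every maximal simplex with vertices $v_0,\dots,v_d$ the differences $v_1-v_0,\dots,v_d-v_0$ form a basis of the lattice of all integer vectors parallel to the affine hull of $\mathscr P_n$. 2. $\mathscr P_n$ contains the Hilbert basis of $\mathscr R_n$, i.e. all irreducible elements of $\mathscr R_n$, and $\mathscr P_n$ is integrally closed: it is a lattice polytope, and for every integer $c\ge 1$ every lattice point of $c\,\mathscr P_n$ is a sum of $c$ lattice points of $\mathscr P_n$. -/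

import Mathlib

namespace ScoreSheets

/-! ### Lattice polytopes, pulling triangulations, unimodularity -/

section Polytopes

variable {ι : Type*} [Fintype ι]

/-- The lattice `ℤ^ι` inside `ℝ^ι`. -/
def latticePoints (ι : Type*) : Set (ι → ℝ) :=
  Set.range fun (z : ι → ℤ) (i : ι) => (z i : ℝ)

/-- A lattice polytope: the convex hull of a finite set of lattice points. -/
def IsLatticePolytope (P : Set (ι → ℝ)) : Prop :=
  ∃ A : Set (ι → ℝ), A.Finite ∧ A ⊆ latticePoints ι ∧ P = convexHull ℝ A

/-- `P` is integrally closed: it is a lattice polytope, and for every integer `c ≥ 1` every lattice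
point of `c P` is a sum of `c` lattice points of `P`. -/
def IsIntegrallyClosedPolytope (P : Set (ι → ℝ)) : Prop :=
  IsLatticePolytope P ∧
    ∀ c : ℕ, 0 < c → ∀ z ∈ latticePoints ι, z ∈ (fun x => (c : ℝ) • x) '' P →
      ∃ x : Fin c → (ι → ℝ), (∀ k, x k ∈ P ∩ latticePoints ι) ∧ z = ∑ k, x k

/-- `G` is a facet of the polytope `F`: a nonempty face of dimension `dim F - 1`. -/
def IsFacet (F G : Set (ι → ℝ)) : Prop :=
  G.Nonempty ∧ IsExposed ℝ F G ∧
    Module.finrank ℝ (vectorSpan ℝ G) + 1 = Module.finrank ℝ (vectorSpan ℝ F)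

/-- `p₀, p₁, …` is an ordering (without repetition) of a set of lattice points of `P` whose convex
hull is `P`, i.e. of a set of lattice points of `P` that contains all vertices of `P`. -/
def IsPullingOrder (P : Set (ι → ℝ)) {N : ℕ} (p : Fin N → (ι → ℝ)) : Prop :=
  Function.Injective p ∧ Set.range p ⊆ latticePoints ι ∧ convexHull ℝ (Set.range p) = P

/-- `p i` is the first point of the sequence `p` that lies in `F`. -/
def IsFirstIn {N : ℕ} (p : Fin N → (ι → ℝ)) (F : Set (ι → ℝ)) (i : Fin N) : Prop :=
  p i ∈ F ∧ ∀ j < i, p j ∉ F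

/-- `PullingCell p F s`: the convex hull of `s` is a maximal simplex of the triangulation of the
polytope `F` obtained by pulling the points `p₀, p₁, …` in this order. A polytope that consists of
a single point is its own triangulation; any other polytope `F` is triangulated by the cones, with
apex the first point of the sequence in `F`, over the maximal simplices of the pulling
triangulations of the facets of `F` that do not contain this apex. -/
inductive PullingCell {N : ℕ} (p : Fin N → (ι → ℝ)) : Set (ι → ℝ) → Set (ι → ℝ) → Prop
  | point (i : Fin N) : PullingCell p {p i} {p i}
  | cone (F G : Set (ι → ℝ)) (i : Fin N) (s : Set (ι → ℝ)) (hi : IsFirstIn p F i)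
      (hG : IsFacet F G) (hiG : p i ∉ G) (hs : PullingCell p G s) :
      PullingCell p F (insert (p i) s)

/-- The pulling triangulation of `P` with respect to the sequence `p`, given by the vertex sets of
its maximal simplices. -/
def pullingTriangulation {N : ℕ} (p : Fin N → (ι → ℝ)) (P : Set (ι → ℝ)) :
    Set (Set (ι → ℝ)) :=
  {s | PullingCell p P s}

/-- The vertex sets in `T` span simplices that cover exactly `P`, and any two of these simplices
meet in the common face spanned by their common vertices. -/
def IsTriangulation (P : Set (ι → ℝ)) (T : Set (Set (ι → ℝ))) : Prop :=
  T.Finite ∧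
  (∀ s ∈ T, s.Finite ∧ s.Nonempty ∧ AffineIndependent ℝ (fun x : s => (x : ι → ℝ))) ∧
  (⋃ s ∈ T, convexHull ℝ s) = P ∧
  ∀ s ∈ T, ∀ t ∈ T, convexHull ℝ s ∩ convexHull ℝ t = convexHull ℝ (s ∩ t)

/-- The simplex with vertex set `s` is unimodular in `P`: its vertices are affinely independent
lattice points, and the differences of its vertices with any fixed one of them generate the
lattice of all integer vectors parallel to the affine hull of `P`. -/
def IsUnimodularSimplex (P s : Set (ι → ℝ)) : Prop :=
  s.Nonempty ∧ s ⊆ latticePoints ι ∧ AffineIndependent ℝ (fun x : s => (x : ι → ℝ)) ∧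
    ∀ v ∈ s, (AddSubgroup.closure ((fun w => w - v) '' s) : Set (ι → ℝ)) =
      latticePoints ι ∩ (vectorSpan ℝ P : Set (ι → ℝ))

/-- `T` is a unimodular triangulation of `P`: a triangulation of `P` all of whose maximal simplices
are unimodular. -/
def IsUnimodularTriangulation (P : Set (ι → ℝ)) (T : Set (Set (ι → ℝ))) : Prop :=
  IsTriangulation P T ∧ ∀ s ∈ T, IsUnimodularSimplex P s

end Polytopes

/-! ### Score sheets -/

/-- The positions `(i, j)`, `i ≠ j`, of the entries of a score sheet of `n` teams. The teams
`T₁, …, Tₙ` are indexed by `0, …, n - 1`. -/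
abbrev Pos (n : ℕ) : Type := {e : Fin n × Fin n // e.1 ≠ e.2}

/-- The number of goals scored by team `i` against the other teams in the set `K`. -/
def goals {n : ℕ} {R : Type*} [AddCommMonoid R] (S : Pos n → R) (K : Finset (Fin n))
    (i : Fin n) : R :=
  ∑ e : Pos n with e.1.1 = i ∧ e.1.2 ∈ K, S e

/-- The principal submatrix of the score sheet `S` on the teams in `K` is an ordered score sheet. -/
def OrderedOn {n : ℕ} (S : Pos n → ℕ) (K : Finset (Fin n)) : Prop :=
  ∀ i ∈ K, ∀ j ∈ K, i ≤ j → goals S K j ≤ goals S K i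

/-- The teams other than the leader team `T₁`. -/
def nonLeaders (n : ℕ) : Finset (Fin n) :=
  Finset.univ.filter fun i => i.val ≠ 0

theorem goals_zero {n : ℕ} (K : Finset (Fin n)) (i : Fin n) :
    goals (0 : Pos n → ℕ) K i = 0 := by
  simp [goals]

theorem goals_add {n : ℕ} (S S' : Pos n → ℕ) (K : Finset (Fin n)) (i : Fin n) :
    goals (S + S') K i = goals S K i + goals S' K i := by
  simp [goals, Finset.sum_add_distrib]

/-- The monoid of runner-up consistent score sheets of `n` teams: ordered score sheets that stay
ordered after the deletion of the first row and the first column. -/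
def runnerUpConsistent (n : ℕ) : AddSubmonoid (Pos n → ℕ) where
  carrier := {S | OrderedOn S Finset.univ ∧ OrderedOn S (nonLeaders n)}
  zero_mem' := ⟨fun i _ j _ _ => by simp [goals_zero], fun i _ j _ _ => by simp [goals_zero]⟩
  add_mem' := fun {S S'} hS hS' =>
    ⟨fun i hi j hj hij => by
        rw [goals_add, goals_add]
        exact add_le_add (hS.1 i hi j hj hij) (hS'.1 i hi j hj hij),
      fun i hi j hj hij => by
        rw [goals_add, goals_add]
        exact add_le_add (hS.2 i hi j hj hij) (hS'.2 i hi j hj hij)⟩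

/-- A score sheet as a vector of `ℝ^{n(n-1)}`. -/
def toReal {n : ℕ} (S : Pos n → ℕ) : Pos n → ℝ := fun e => (S e : ℝ)

/-- The cone `ℝ₊ ℛₙ`: all linear combinations of runner-up consistent score sheets with
nonnegative real coefficients. -/
def runnerUpCone (n : ℕ) : PointedCone ℝ (Pos n → ℝ) :=
  PointedCone.hull ℝ (toReal '' (runnerUpConsistent n : Set (Pos n → ℕ)))

/-- The number of goals `g₁` scored by the team `T₁`, as a linear form on `ℝ^{n(n-1)}`. -/
def leaderGoals {n : ℕ} (x : Pos n → ℝ) : ℝ :=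
  ∑ e : Pos n with e.1.1.val = 0, x e

/-- The polytope `𝒫ₙ`: the slice `g₁ = 1` of the cone `ℝ₊ ℛₙ`. -/
def runnerUpPolytope (n : ℕ) : Set (Pos n → ℝ) :=
  {x | x ∈ runnerUpCone n ∧ leaderGoals x = 1}

/-- The Hilbert basis of an affine monoid of score sheets: the set of its irreducible elements. -/
def hilbertBasis {n : ℕ} (M : AddSubmonoid (Pos n → ℕ)) : Set (Pos n → ℕ) :=
  {x | ∃ h : x ∈ M, AddIrreducible (⟨x, h⟩ : M)}

end ScoreSheets

/-!
The polytope `𝒫ₙ` has an integral description by inequalities with respect to which it has width at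
most one, and such lattice polytopes are known to have only unimodular pulling triangulations.

*Pulling triangulations.* Let `P` be a polytope given by inequalities `b k ≤ ℓ k x`. A facet of a
face `F` that misses a point `q` of `F` is cut out of `F` by one inequality that is strict at `q`
(`IsFacet.eq_tightFace`), and projection from `q` carries each point of `F` to such a facet
(`exists_facet_mem_segment`). Hence the cells of a pulling triangulation cover. That cells of any
two faces `F`, `H` meet in the hull of their common vertices is shown by induction on the two cells
(`PullingCell.convexHull_inter_subset`): if `F` and `H` have the same first point, the projections
of a common point of the two cells to the opposite facets coincide; otherwise the earlier one of the
two first points is not in the other face and can be dropped from its cell. If the forms `ℓ k` are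
integral and all slacks on `P` are at most one, then the apex of each cone has lattice distance one
from its base, so a lattice basis of the direction of the base is completed to one of the face by an
edge at the apex (`PullingCell.subset_closure`).

*Score sheets.* The slice `g₁ = 1` of the cone given by `x ≥ 0` and the inequalities of runner-up
consistency has width at most one, since `g₁` bounds all other numbers of goals. The combinatorial
core is `exists_singleGoalSheet`: for every nonzero real vector `x` of the cone there is a score
sheet with `g₁ = 1` for which all inequalities are tight that are tight at `x`. Applied to a vertex
`x` of the slice it shows that `x` is this sheet, so by the theorem of Krein and Milman the slice is
the convex hull of the score sheets in it, and equals `𝒫ₙ`. Applied to a score sheet `x` it gives a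
sheet that can be subtracted from `x` within the monoid (`exists_eq_add_of_ne_zero`), from which the
claims on the Hilbert basis and on integral closedness follow.
-/

namespace ScoreSheets

/-! ### Faces of polyhedra -/

section Polyhedra

variable {ι κ : Type*}

/-- The polyhedron of all points that satisfy the inequalities `b k ≤ ℓ k x`. -/
def polyhedron (ℓ : κ → (ι → ℝ) →ₗ[ℝ] ℝ) (b : κ → ℝ) : Set (ι → ℝ) :=
  {x | ∀ k, b k ≤ ℓ k x}

/-- The face of a polyhedron on which the inequalities with index in `I` are equalities. -/
def tightFace (ℓ : κ → (ι → ℝ) →ₗ[ℝ] ℝ) (b : κ → ℝ) (I : Set κ) : Set (ι → ℝ) :=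
  {x | x ∈ polyhedron ℓ b ∧ ∀ k ∈ I, ℓ k x = b k}

variable {ℓ : κ → (ι → ℝ) →ₗ[ℝ] ℝ} {b : κ → ℝ} {I : Set κ}

theorem tightFace_subset : tightFace ℓ b I ⊆ polyhedron ℓ b := fun _ hx => hx.1

theorem tightFace_empty : tightFace ℓ b ∅ = polyhedron ℓ b := by
  ext x; simp [tightFace]

theorem tightFace_insert (k : κ) :
    tightFace ℓ b (insert k I) = {x | x ∈ tightFace ℓ b I ∧ ℓ k x = b k} := by
  ext x
  simp only [tightFace, Set.mem_insert_iff, forall_eq_or_imp, Set.mem_ofPred_eq]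
  tauto

theorem convex_polyhedron : Convex ℝ (polyhedron ℓ b) := by
  have : polyhedron ℓ b = ⋂ k, {x | b k ≤ ℓ k x} := by ext x; simp [polyhedron]
  rw [this]
  exact convex_iInter fun k => convex_halfSpace_ge (ℓ k).isLinear _

theorem convex_tightFace : Convex ℝ (tightFace ℓ b I) := by
  have : tightFace ℓ b I = polyhedron ℓ b ∩ ⋂ k ∈ I, {x | ℓ k x = b k} := by
    ext x; simp [tightFace]
  rw [this]
  exact convex_polyhedron.inter
    (convex_iInter₂ fun k _ => convex_hyperplane (ℓ k).isLinear _)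

/-- A linear form that is constant on a set vanishes on the direction of the set. -/
theorem vectorSpan_le_ker {G : Set (ι → ℝ)} {f : (ι → ℝ) →ₗ[ℝ] ℝ} {c : ℝ}
    (h : ∀ x ∈ G, f x = c) : vectorSpan ℝ G ≤ LinearMap.ker f := by
  rw [vectorSpan_def, Submodule.span_le]
  rintro _ ⟨x, hx, y, hy, rfl⟩
  simp [h x hx, h y hy]

/-- Faces are extreme: a segment of the polyhedron that meets a face in a point other than its far
end has its starting point in the face. -/
theorem mem_tightFace_of_mem_segment {q u x : ι → ℝ} (hq : q ∈ polyhedron ℓ b)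
    (hu : u ∈ polyhedron ℓ b) (hx : x ∈ tightFace ℓ b I) (hseg : x ∈ segment ℝ q u)
    (hxu : x ≠ u) : q ∈ tightFace ℓ b I := by
  obtain ⟨s, t, hs, ht, hst, rfl⟩ := hseg
  have hs' : 0 < s := by
    rcases hs.eq_or_lt with h | h
    · subst h
      exact absurd (by simp [show t = 1 by linarith]) hxu
    · exact h
  refine ⟨hq, fun k hk => ?_⟩
  have h1 := hx.2 k hk
  simp only [map_add, map_smul, smul_eq_mul] at h1
  have h2 := hq k
  have h3 := hu k
  have h4 : s * (ℓ k q - b k) + t * (ℓ k u - b k) = 0 := by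
    linear_combination h1 - b k * hst
  nlinarith [mul_nonneg ht (sub_nonneg.2 h3), mul_nonneg hs (sub_nonneg.2 h2),
    mul_pos hs' hs']

/-- A step small enough keeps finitely many positive slacks nonnegative. -/
theorem exists_pos_mul_abs_le [Finite κ] (a c : κ → ℝ) :
    ∃ ε : ℝ, 0 < ε ∧ ∀ k, 0 < a k → ε * |c k| ≤ a k := by
  have h : ∀ᶠ ε : ℝ in nhdsWithin 0 (Set.Ioi 0), ∀ k, 0 < a k → ε * |c k| ≤ a k := by
    rw [Filter.eventually_all]
    intro k
    by_cases hk : 0 < a k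
    · have : Filter.Tendsto (fun ε : ℝ => ε * |c k|) (nhdsWithin 0 (Set.Ioi 0)) (nhds 0) := by
        have h0 : Filter.Tendsto (fun ε : ℝ => ε * |c k|) (nhds 0) (nhds (0 * |c k|)) :=
          (continuous_id.mul continuous_const).tendsto 0
        rw [zero_mul] at h0
        exact h0.mono_left nhdsWithin_le_nhds
      filter_upwards [this.eventually (gt_mem_nhds hk)] with ε hε _
      exact hε.le
    · exact Filter.Eventually.of_forall fun ε h => absurd h hk
  obtain ⟨ε, h1, h2⟩ := (h.and self_mem_nhdsWithin).exists
  exact ⟨ε, h2, h1⟩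

/-- A nonempty convex subset of a polyhedron has a point at which only those inequalities are tight
that are tight on the whole subset. -/
theorem exists_strict [Finite κ] {G : Set (ι → ℝ)} (hG : Convex ℝ G) (hne : G.Nonempty)
    (hsub : G ⊆ polyhedron ℓ b) :
    ∃ y ∈ G, ∀ k, (∃ x ∈ G, ℓ k x ≠ b k) → b k < ℓ k y := by
  classical
  cases nonempty_fintype κ
  suffices h : ∀ s : Finset κ, ∃ y ∈ G, ∀ k ∈ s, (∃ x ∈ G, ℓ k x ≠ b k) → b k < ℓ k y by
    obtain ⟨y, hy, h⟩ := h Finset.univ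
    exact ⟨y, hy, fun k => h k (Finset.mem_univ k)⟩
  intro s
  induction s using Finset.induction_on with
  | empty => exact ⟨hne.some, hne.some_mem, by simp⟩
  | insert k s _ ih =>
    obtain ⟨y, hy, h⟩ := ih
    by_cases hk : ∃ x ∈ G, ℓ k x ≠ b k
    · obtain ⟨x, hx, hxk⟩ := hk
      refine ⟨(1 / 2 : ℝ) • y + (1 / 2 : ℝ) • x,
        hG hy hx (by norm_num) (by norm_num) (by norm_num), fun j hj hj' => ?_⟩
      simp only [map_add, map_smul, smul_eq_mul]
      have h1 := hsub hy j
      have h2 := hsub hx j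
      rcases Finset.mem_insert.1 hj with rfl | hj
      · have := lt_of_le_of_ne h2 (Ne.symm hxk)
        linarith
      · have := h j hj hj'
        linarith
    · refine ⟨y, hy, fun j hj hj' => ?_⟩
      rcases Finset.mem_insert.1 hj with rfl | hj
      · exact absurd hj' hk
      · exact h j hj hj'

/-- If a polyhedron is the convex hull of a set, each nonempty face meets this set. -/
theorem exists_mem_tightFace [Finite κ] {V : Set (ι → ℝ)}
    (hV : convexHull ℝ V = polyhedron ℓ b) (hne : (tightFace ℓ b I).Nonempty) :
    ∃ v ∈ V, v ∈ tightFace ℓ b I := by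
  classical
  cases nonempty_fintype κ
  by_contra! hcon
  obtain ⟨x, hx⟩ := hne
  -- the total slack of the inequalities in `I` is a linear form that separates `V` from `x`
  let f : (ι → ℝ) →ₗ[ℝ] ℝ := ∑ k : κ with k ∈ I, ℓ k
  let c : ℝ := ∑ k : κ with k ∈ I, b k
  have hf : ∀ y, f y - c = ∑ k : κ with k ∈ I, (ℓ k y - b k) := by
    intro y; simp [f, c, Finset.sum_sub_distrib]
  have hVP : V ⊆ polyhedron ℓ b := hV ▸ subset_convexHull ℝ V
  have h1 : V ⊆ {y | c < f y} := by
    intro v hv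
    rw [Set.mem_ofPred_eq, ← sub_pos, hf]
    have hv' := hcon v hv
    have : ∃ k ∈ I, ℓ k v ≠ b k := by
      by_contra! h
      exact hv' ⟨hVP hv, h⟩
    obtain ⟨k, hk, hkv⟩ := this
    refine Finset.sum_pos' (fun j _ => sub_nonneg.2 (hVP hv j))
      ⟨k, by simpa using hk, sub_pos.2 (lt_of_le_of_ne (hVP hv k) (Ne.symm hkv))⟩
  have h2 := convexHull_min h1 (convex_halfSpace_gt f.isLinear c)
  have h3 : c < f x := h2 (hV ▸ hx.1)
  have h4 : f x - c = 0 := by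
    rw [hf]
    refine Finset.sum_eq_zero fun k hk => ?_
    rw [hx.2 k (by simpa using hk), sub_self]
  linarith

theorem finrank_inf_ker_add_one [Fintype ι] {D : Submodule ℝ (ι → ℝ)} {f : (ι → ℝ) →ₗ[ℝ] ℝ}
    {d : ι → ℝ} (hd : d ∈ D) (hfd : f d ≠ 0) :
    Module.finrank ℝ (D ⊓ LinearMap.ker f : Submodule ℝ (ι → ℝ)) + 1 = Module.finrank ℝ D := by
  have h0 : f.domRestrict D ≠ 0 := fun h => hfd (by
    simpa using LinearMap.congr_fun h ⟨d, hd⟩)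
  rw [← Module.Dual.finrank_ker_add_one_of_ne_zero (f := f.domRestrict D) h0]
  congr 1
  have : (LinearMap.ker (f.domRestrict D)).map D.subtype = D ⊓ LinearMap.ker f := by
    ext x
    simp only [Submodule.mem_map, LinearMap.mem_ker, LinearMap.domRestrict_apply,
      Submodule.subtype_apply, Submodule.mem_inf]
    exact ⟨by rintro ⟨y, hy, rfl⟩; exact ⟨y.2, hy⟩, fun h => ⟨⟨x, h.1⟩, h.2, rfl⟩⟩
  rw [← this]
  exact Submodule.finrank_map_subtype_eq D _

/-- A facet of a face that misses a point `q` of the face is cut out by one more inequality, which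
is strict at `q`. -/
theorem IsFacet.eq_tightFace [Fintype ι] [Finite κ] {G : Set (ι → ℝ)} {q : ι → ℝ}
    (hG : IsFacet (tightFace ℓ b I) G) (hq : q ∈ tightFace ℓ b I) (hqG : q ∉ G) :
    ∃ k, G = tightFace ℓ b (insert k I) ∧ b k < ℓ k q ∧
      vectorSpan ℝ G = vectorSpan ℝ (tightFace ℓ b I) ⊓ LinearMap.ker (ℓ k) := by
  obtain ⟨hne, hexp, hdim⟩ := hG
  have hGF := hexp.subset
  have hGconv : Convex ℝ G := hexp.convex convex_tightFace
  obtain ⟨l, hl⟩ := hexp hne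
  obtain ⟨y, hy, hys⟩ := exists_strict hGconv hne (hGF.trans tightFace_subset)
  have hk : ∃ k, (∀ x ∈ G, ℓ k x = b k) ∧ b k < ℓ k q := by
    by_contra! hcon
    -- otherwise the segment from `q` to `y` can be prolonged beyond `y` inside the face, which
    -- contradicts the maximality of the exposing form at `y`
    obtain ⟨ε, hε, hεk⟩ := exists_pos_mul_abs_le (fun k => ℓ k y - b k) (fun k => ℓ k y - ℓ k q)
    have hz : y + ε • (y - q) ∈ tightFace ℓ b I := by
      have hyF := hGF hy
      refine ⟨fun k => ?_, fun k hk => ?_⟩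
      · simp only [map_add, map_smul, map_sub, smul_eq_mul]
        by_cases hkG : ∀ x ∈ G, ℓ k x = b k
        · rw [hkG y hy, le_antisymm (hcon k hkG) (hq.1 k)]; simp
        · push Not at hkG
          have h1 := hεk k (sub_pos.2 (hys k hkG))
          have h2 := mul_le_mul_of_nonneg_left (neg_abs_le (ℓ k y - ℓ k q)) hε.le
          linarith
      · simp only [map_add, map_smul, map_sub, smul_eq_mul, hyF.2 k hk, hq.2 k hk]; simp
    rw [hl] at hy hqG
    have h1 := hy.2 _ hz
    have h2 : l q < l y := by
      by_contra! h
      exact hqG ⟨hq, fun z hz => (hy.2 z hz).trans h⟩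
    simp only [map_add, map_smul, map_sub, smul_eq_mul] at h1
    nlinarith [mul_pos hε (sub_pos.2 h2)]
  obtain ⟨k, hkG, hkq⟩ := hk
  have hsub : G ⊆ tightFace ℓ b (insert k I) := by
    rw [tightFace_insert]
    exact fun x hx => ⟨hGF hx, hkG x hx⟩
  have hsub' : tightFace ℓ b (insert k I) ⊆ tightFace ℓ b I := by
    rw [tightFace_insert]
    exact fun x hx => hx.1
  have hle : vectorSpan ℝ (tightFace ℓ b (insert k I)) ≤
      vectorSpan ℝ (tightFace ℓ b I) ⊓ LinearMap.ker (ℓ k) :=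
    le_inf (vectorSpan_mono ℝ hsub') (vectorSpan_le_ker (c := b k) (by
      rw [tightFace_insert]; exact fun x hx => hx.2))
  have hrank := finrank_inf_ker_add_one (f := ℓ k)
    (vsub_mem_vectorSpan ℝ hq (hGF hy)) (by
      rw [vsub_eq_sub, map_sub, hkG y hy]; exact (sub_pos.2 hkq).ne')
  have hspan : vectorSpan ℝ G = vectorSpan ℝ (tightFace ℓ b I) ⊓ LinearMap.ker (ℓ k) :=
    Submodule.eq_of_le_of_finrank_eq ((vectorSpan_mono ℝ hsub).trans hle) (by omega)
  refine ⟨k, hsub.antisymm fun x hx => ?_, hkq, hspan⟩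
  -- the exposing form is constant on `G`, hence on the affine hull of `G`
  have hmax : ∀ z ∈ G, l z = l y := by
    intro z hz
    rw [hl] at hz hy
    exact le_antisymm (hy.2 z hz.1) (hz.2 y hy.1)
  have h1 : x - y ∈ vectorSpan ℝ G :=
    hspan ▸ hle (vsub_mem_vectorSpan ℝ hx (hsub hy))
  have h2 : l (x - y) = 0 := vectorSpan_le_ker (f := l.toLinearMap) hmax h1
  rw [map_sub, sub_eq_zero] at h2
  rw [hl] at hy ⊢
  exact ⟨hsub' hx, fun z hz => h2 ▸ hy.2 z hz⟩

theorem isExposed_tightFace_insert [Fintype ι] (k : κ) :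
    IsExposed ℝ (tightFace ℓ b I) (tightFace ℓ b (insert k I)) := by
  rintro ⟨y, hy⟩
  refine ⟨-(LinearMap.toContinuousLinearMap (ℓ k)), ?_⟩
  rw [tightFace_insert] at hy ⊢
  ext x
  simp only [Set.mem_ofPred_eq, neg_apply, neg_le_neg_iff,
    LinearMap.coe_toContinuousLinearMap']
  refine and_congr_right fun hx => ⟨fun h z hz => h ▸ hz.1 k, fun h => le_antisymm ?_ (hx.1 k)⟩
  exact hy.2 ▸ h y hy.1

/-- In a bounded polyhedron, each point of a face other than `q` lies on a segment from `q` to a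
point of a facet of the face that misses `q`. -/
theorem exists_facet_mem_segment [Fintype ι] [Finite κ]
    (hbdd : Bornology.IsBounded (polyhedron ℓ b)) {q x : ι → ℝ}
    (hq : q ∈ tightFace ℓ b I) (hx : x ∈ tightFace ℓ b I) (hxq : x ≠ q) :
    ∃ k, q ∉ tightFace ℓ b (insert k I) ∧
      IsFacet (tightFace ℓ b I) (tightFace ℓ b (insert k I)) ∧
      ∃ u ∈ tightFace ℓ b (insert k I), x ∈ segment ℝ q u := by
  classical
  cases nonempty_fintype κ
  set F := tightFace ℓ b I with hF
  set D := vectorSpan ℝ F with hD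
  have hconst : ∀ k, (∀ y ∈ F, ℓ k y = b k) → ∀ z, z - q ∈ D → ℓ k z = b k := by
    intro k hk z hz
    have : ℓ k (z - q) = 0 := vectorSpan_le_ker hk hz
    rw [map_sub, hk q hq, sub_eq_zero] at this
    exact this
  -- a minimal set of inequalities that cuts the face out of its affine hull
  let Q : Finset κ → Prop := fun s => ∀ z, z - q ∈ D → (∀ k ∈ s, b k ≤ ℓ k z) → z ∈ F
  have hQ : ∃ s, Q s := ⟨Finset.univ, fun z hz h =>
    ⟨fun k => h k (Finset.mem_univ k), fun k hk => hconst k (fun y hy => hy.2 k hk) z hz⟩⟩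
  obtain ⟨K, hK, hKmin⟩ : ∃ K, Q K ∧ ∀ k ∈ K, ¬ Q (K.erase k) := by
    obtain ⟨K, hK⟩ := exists_minimal_of_wellFoundedLT Q hQ
    exact ⟨K, hK.1, fun k hk h => by
      have := hK.2 h (Finset.erase_subset k K)
      exact absurd (this hk) (Finset.notMem_erase k K)⟩
  obtain ⟨y, hy, hys⟩ := exists_strict (convex_tightFace (ℓ := ℓ) (b := b) (I := I)) ⟨q, hq⟩
    tightFace_subset
  have hyD : y - q ∈ D := vsub_mem_vectorSpan ℝ hy hq
  have hout : ∀ k ∈ K, ∃ z, z - q ∈ D ∧ (∀ j ∈ K.erase k, b j ≤ ℓ j z) ∧ ℓ k z < b k := by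
    intro k hk
    have := hKmin k hk
    simp only [Q] at this
    push Not at this
    obtain ⟨z, hz, hzj, hzF⟩ := this
    refine ⟨z, hz, hzj, ?_⟩
    by_contra! h
    refine hzF (hK z hz fun j hj => ?_)
    by_cases hjk : j = k
    · exact hjk ▸ h
    · exact hzj j (Finset.mem_erase.2 ⟨hjk, hj⟩)
  have hpos : ∀ k ∈ K, b k < ℓ k y := by
    intro k hk
    refine hys k ?_
    by_contra! h
    obtain ⟨z, hz, -, hzk⟩ := hout k hk
    exact hzk.ne (hconst k h z hz)
  -- minimality makes each of these inequalities define a facet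
  have hfacet : ∀ k ∈ K, b k < ℓ k q → (tightFace ℓ b (insert k I)).Nonempty →
      IsFacet F (tightFace ℓ b (insert k I)) := by
    intro k hk hkq hne
    refine ⟨hne, isExposed_tightFace_insert k, ?_⟩
    obtain ⟨u, hu⟩ := hne
    rw [tightFace_insert] at hu
    have hrank := finrank_inf_ker_add_one (f := ℓ k) (D := D)
      (vsub_mem_vectorSpan ℝ hq hu.1) (by
        rw [vsub_eq_sub, map_sub, hu.2]; exact (sub_pos.2 hkq).ne')
    suffices h : vectorSpan ℝ (tightFace ℓ b (insert k I)) = D ⊓ LinearMap.ker (ℓ k) by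
      rw [h, hrank]
    refine le_antisymm (le_inf (vectorSpan_mono ℝ ?_) (vectorSpan_le_ker (c := b k) ?_)) ?_
    · rw [tightFace_insert]; exact fun x hx => hx.1
    · rw [tightFace_insert]; exact fun x hx => hx.2
    · rintro d ⟨hdD, hdk⟩
      obtain ⟨z, hz, hzj, hzk⟩ := hout k hk
      have hyk := hpos k hk
      obtain ⟨s, hs0, hs1, hs⟩ : ∃ s : ℝ, 0 < s ∧ s < 1 ∧
          s * (ℓ k y - ℓ k z) = ℓ k y - b k := by
        have hden : 0 < ℓ k y - ℓ k z := by linarith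
        refine ⟨(ℓ k y - b k) / (ℓ k y - ℓ k z), div_pos (by linarith) hden, ?_, ?_⟩
        · rw [div_lt_one hden]; linarith
        · field_simp
      set w := y + s • (z - y) with hw
      have hwj : ∀ j, ℓ j w = (1 - s) * ℓ j y + s * ℓ j z := by
        intro j; simp [hw]; ring
      have hwk : ℓ k w = b k := by rw [hwj]; linarith
      have hwpos : ∀ j ∈ K, j ≠ k → 0 < ℓ j w - b j := by
        intro j hj hjk
        have h1 := hpos j hj
        have h2 := hzj j (Finset.mem_erase.2 ⟨hjk, hj⟩)
        rw [hwj]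
        nlinarith [mul_pos (sub_pos.2 hs1) (sub_pos.2 h1), mul_nonneg hs0.le (sub_nonneg.2 h2)]
      have hwD : w - q ∈ D := by
        have : w - q = (1 - s) • (y - q) + s • (z - q) := by rw [hw]; module
        rw [this]
        exact D.add_mem (D.smul_mem _ hyD) (D.smul_mem _ hz)
      obtain ⟨ε, hε, hεj⟩ := exists_pos_mul_abs_le (fun j => ℓ j w - b j) (fun j => ℓ j d)
      have hdk' : ℓ k d = 0 := hdk
      have hmem : ∀ δ : ℝ, δ = 0 ∨ δ = ε → w + δ • d ∈ tightFace ℓ b (insert k I) := by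
        intro δ hδ
        rw [tightFace_insert]
        refine ⟨hK _ ?_ fun j hj => ?_, by simp [hwk, hdk']⟩
        · rw [add_sub_right_comm]
          exact D.add_mem hwD (D.smul_mem _ hdD)
        · simp only [map_add, map_smul, smul_eq_mul]
          by_cases hjk : j = k
          · rw [hjk, hwk, hdk']; simp
          · have h1 := hwpos j hj hjk
            rcases hδ with rfl | rfl
            · linarith
            · have h2 := hεj j h1
              have h3 := mul_le_mul_of_nonneg_left (neg_abs_le (ℓ j d)) hε.le
              linarith
      have h1 := vsub_mem_vectorSpan ℝ (hmem ε (Or.inr rfl)) (hmem 0 (Or.inl rfl))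
      have h2 := Submodule.smul_mem _ ε⁻¹ h1
      have h3 : ε⁻¹ • ((w + ε • d) -ᵥ (w + (0 : ℝ) • d)) = d := by
        rw [vsub_eq_sub, zero_smul, add_zero, add_sub_cancel_left, smul_smul,
          inv_mul_cancel₀ hε.ne', one_smul]
      rwa [h3] at h2
  -- the ray from `q` through `x` leaves the face, since the polyhedron is bounded
  have hxD : x - q ∈ D := vsub_mem_vectorSpan ℝ hx hq
  have hray : ∀ t : ℝ, q + t • (x - q) - q ∈ D := by
    intro t; rw [add_sub_cancel_left]; exact D.smul_mem _ hxD
  have hdec : (K.filter fun k => ℓ k x < ℓ k q).Nonempty := by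
    by_contra hempty
    rw [Finset.not_nonempty_iff_eq_empty, Finset.filter_eq_empty_iff] at hempty
    obtain ⟨C, hC⟩ := hbdd.exists_norm_le
    have hnorm : 0 < ‖x - q‖ := norm_pos_iff.2 (sub_ne_zero.2 hxq)
    have hin : ∀ t : ℝ, 0 ≤ t → q + t • (x - q) ∈ F := by
      intro t ht
      refine hK _ (hray t) fun k hk => ?_
      have h1 := hempty hk
      have h2 := hq.1 k
      simp only [map_add, map_smul, map_sub, smul_eq_mul]
      nlinarith [mul_nonneg ht (sub_nonneg.2 (not_lt.1 h1))]
    have hC0 : 0 ≤ C := (norm_nonneg q).trans (hC q hq.1)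
    set t := (C + ‖q‖ + 1) / ‖x - q‖ with ht
    have ht0 : 0 ≤ t := by positivity
    have h1 := hC _ (hin t ht0).1
    have h2 : ‖t • (x - q)‖ = C + ‖q‖ + 1 := by
      rw [norm_smul, Real.norm_of_nonneg ht0, ht]; field_simp
    have h3 : ‖t • (x - q)‖ ≤ ‖q + t • (x - q)‖ + ‖q‖ := by
      simpa using norm_sub_le (q + t • (x - q)) q
    linarith
  obtain ⟨k, hk, hkmin⟩ := Finset.exists_min_image (K.filter fun k => ℓ k x < ℓ k q)
    (fun k => (ℓ k q - b k) / (ℓ k q - ℓ k x)) hdec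
  rw [Finset.mem_filter] at hk
  obtain ⟨hkK, hkx⟩ := hk
  set t := (ℓ k q - b k) / (ℓ k q - ℓ k x) with ht
  have hden : 0 < ℓ k q - ℓ k x := by linarith
  have hkb := hx.1 k
  have ht1 : 1 ≤ t := by rw [ht, one_le_div hden]; linarith
  have htk : t * (ℓ k q - ℓ k x) = ℓ k q - b k := by rw [ht]; field_simp
  have huF : q + t • (x - q) ∈ F := by
    refine hK _ (hray t) fun j hj => ?_
    simp only [map_add, map_smul, map_sub, smul_eq_mul]
    by_cases hjx : ℓ j x < ℓ j q
    · have h1 := hkmin j (Finset.mem_filter.2 ⟨hj, hjx⟩)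
      have h2 := (le_div_iff₀ (sub_pos.2 hjx)).1 h1
      linarith
    · have := hq.1 j
      nlinarith [mul_nonneg (zero_le_one.trans ht1) (sub_nonneg.2 (not_lt.1 hjx))]
  have hu : q + t • (x - q) ∈ tightFace ℓ b (insert k I) := by
    rw [tightFace_insert]
    refine ⟨huF, ?_⟩
    simp only [map_add, map_smul, map_sub, smul_eq_mul]
    linarith
  have hkq : b k < ℓ k q := hkb.trans_lt hkx
  refine ⟨k, fun h => ?_, hfacet k hkK hkq ⟨_, hu⟩, _, hu, ?_⟩
  · exact hkq.ne' (h.2 k (Set.mem_insert k I))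
  · have ht0 : 0 < t := by linarith
    refine ⟨1 - t⁻¹, t⁻¹, sub_nonneg.2 (inv_le_one_of_one_le₀ ht1), by positivity, by ring, ?_⟩
    rw [smul_add, smul_smul, inv_mul_cancel₀ ht0.ne', one_smul]
    module

end Polyhedra

/-! ### Pulling triangulations of polytopes -/

section Pulling

variable {ι κ : Type*} {ℓ : κ → (ι → ℝ) →ₗ[ℝ] ℝ} {b : κ → ℝ} {N : ℕ}
  {p : Fin N → (ι → ℝ)}

theorem PullingCell.nonempty {F s : Set (ι → ℝ)} (h : PullingCell p F s) : s.Nonempty := by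
  cases h with
  | point i => exact Set.singleton_nonempty _
  | cone => exact Set.insert_nonempty _ _

theorem PullingCell.subset {F s : Set (ι → ℝ)} (h : PullingCell p F s) : s ⊆ F := by
  induction h with
  | point i => exact subset_rfl
  | cone F G i s hi hG _ _ ih => exact Set.insert_subset hi.1 (ih.trans hG.2.1.subset)

theorem PullingCell.subset_range {F s : Set (ι → ℝ)} (h : PullingCell p F s) :
    s ⊆ Set.range p := by
  induction h with
  | point i => exact Set.singleton_subset_iff.2 ⟨i, rfl⟩
  | cone F G i s hi hG _ _ ih => exact Set.insert_subset ⟨i, rfl⟩ ih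

theorem finite_pullingTriangulation (P : Set (ι → ℝ)) : (pullingTriangulation p P).Finite :=
  (Set.finite_range p).finite_subsets.subset fun _ hs => PullingCell.subset_range hs

theorem PullingCell.convexHull_subset {I : Set κ} {s : Set (ι → ℝ)}
    (h : PullingCell p (tightFace ℓ b I) s) : convexHull ℝ s ⊆ tightFace ℓ b I :=
  convexHull_min h.subset convex_tightFace

/-- Adding a point outside of a hyperplane to affinely independent points on the hyperplane keeps
the affine independence. -/
theorem affineIndependent_insert_of_forall_eq {s : Set (ι → ℝ)} {q : ι → ℝ}
    (hs : AffineIndependent ℝ (fun x : s => (x : ι → ℝ))) {f : (ι → ℝ) →ₗ[ℝ] ℝ} {c : ℝ}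
    (hf : ∀ x ∈ s, f x = c) (hq : f q ≠ c) :
    AffineIndependent ℝ (fun x : (insert q s : Set (ι → ℝ)) => (x : ι → ℝ)) := by
  set T : Set (ι → ℝ) := insert q s with hT
  have hqs : q ∉ s := fun h => hq (hf q h)
  refine AffineIndependent.affineIndependent_of_notMem_span (i := ⟨q, Set.mem_insert q s⟩) ?_ ?_
  · let e : {y : T // y ≠ ⟨q, Set.mem_insert q s⟩} ↪ s :=
      ⟨fun y => ⟨y.1.1, y.1.2.resolve_left fun h => y.2 (Subtype.ext h)⟩,
        fun y z h => Subtype.ext (Subtype.ext (congrArg (fun x : s => (x : ι → ℝ)) h))⟩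
    exact hs.comp_embedding e
  · intro hmem
    have himg : (fun x : T => (x : ι → ℝ)) '' {x | x ≠ ⟨q, Set.mem_insert q s⟩} ⊆ s := by
      rintro _ ⟨y, hy, rfl⟩
      exact y.2.resolve_left fun h => hy (Subtype.ext h)
    have hmem' := affineSpan_mono ℝ himg hmem
    obtain ⟨v, hv⟩ : s.Nonempty := (affineSpan_nonempty ℝ).1 ⟨_, hmem'⟩
    have h1 : q - v ∈ vectorSpan ℝ s := by
      rw [← direction_affineSpan]
      exact AffineSubspace.vsub_mem_direction hmem' (subset_affineSpan ℝ s hv)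
    have h2 : f (q - v) = 0 := vectorSpan_le_ker hf h1
    rw [map_sub, hf v hv, sub_eq_zero] at h2
    exact hq h2

theorem PullingCell.affineIndependent [Fintype ι] [Finite κ] {I : Set κ} {s : Set (ι → ℝ)}
    (h : PullingCell p (tightFace ℓ b I) s) :
    AffineIndependent ℝ (fun x : s => (x : ι → ℝ)) := by
  generalize hF : tightFace ℓ b I = F at h
  induction h generalizing I with
  | point i => exact affineIndependent_of_subsingleton ℝ _
  | cone F G i s hi hG hiG hs ih =>
    subst hF
    obtain ⟨k, rfl, hk, -⟩ := hG.eq_tightFace hi.1 hiG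
    exact affineIndependent_insert_of_forall_eq (ih rfl)
      (fun x hx => (hs.subset hx).2 k (Set.mem_insert k I)) hk.ne'

/-- The cells of the pulling triangulation cover: from the apex, each point is projected to a facet
that misses the apex. -/
theorem exists_pullingCell [Fintype ι] [Finite κ] (hp : convexHull ℝ (Set.range p) = polyhedron ℓ b) (I : Set κ)
    {x : ι → ℝ} (hx : x ∈ tightFace ℓ b I) :
    ∃ s, PullingCell p (tightFace ℓ b I) s ∧ x ∈ convexHull ℝ s := by
  have hbdd : Bornology.IsBounded (polyhedron ℓ b) :=
    hp ▸ ((Set.finite_range p).isCompact_convexHull ℝ).isBounded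
  induction hd : Module.finrank ℝ (vectorSpan ℝ (tightFace ℓ b I)) using Nat.strong_induction_on
    generalizing I x with
  | _ d ih =>
  classical
  have hex : ∃ i, p i ∈ tightFace ℓ b I := by
    obtain ⟨_, ⟨i, rfl⟩, hi⟩ := exists_mem_tightFace hp ⟨x, hx⟩
    exact ⟨i, hi⟩
  obtain ⟨i, hi⟩ : ∃ i, IsFirstIn p (tightFace ℓ b I) i := by
    obtain ⟨i, hi, hmin⟩ := WellFounded.has_min (wellFounded_lt (α := Fin N))
      {i | p i ∈ tightFace ℓ b I} hex
    exact ⟨i, hi, fun j hj h => hmin j h hj⟩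
  by_cases hsing : tightFace ℓ b I = {p i}
  · rw [hsing] at hx ⊢
    exact ⟨{p i}, .point i, by simpa using hx⟩
  have hcone : ∀ y ∈ tightFace ℓ b I, y ≠ p i →
      ∃ s, PullingCell p (tightFace ℓ b I) s ∧ p i ∈ s ∧ y ∈ convexHull ℝ s := by
    intro y hy hyi
    obtain ⟨k, hik, hfac, u, hu, hyu⟩ := exists_facet_mem_segment hbdd hi.1 hy hyi
    obtain ⟨s, hs, hus⟩ := ih _ (by have := hfac.2.2; omega) (insert k I) hu rfl
    refine ⟨insert (p i) s, .cone _ _ i s hi hfac hik hs, Set.mem_insert _ _, ?_⟩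
    rw [convexHull_insert hs.nonempty, mem_convexJoin]
    exact ⟨p i, rfl, u, hus, hyu⟩
  by_cases hxi : x = p i
  · obtain ⟨y, hy, hyi⟩ : ∃ y ∈ tightFace ℓ b I, y ≠ p i := by
      by_contra! h
      exact hsing (Set.eq_singleton_iff_unique_mem.2 ⟨hi.1, h⟩)
    obtain ⟨s, hs, his, -⟩ := hcone y hy hyi
    exact ⟨s, hs, hxi ▸ subset_convexHull ℝ s his⟩
  · obtain ⟨s, hs, -, hxs⟩ := hcone x hx hxi
    exact ⟨s, hs, hxs⟩

/-- A face that misses the apex of a cone over a set meets the cone only in the hull of the set. -/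
theorem mem_convexHull_of_mem_insert {I : Set κ} {q x : ι → ℝ} {s : Set (ι → ℝ)}
    (hs : s.Nonempty) (hsP : s ⊆ polyhedron ℓ b) (hq : q ∈ polyhedron ℓ b)
    (hqI : q ∉ tightFace ℓ b I) (hx : x ∈ tightFace ℓ b I)
    (hxs : x ∈ convexHull ℝ (insert q s)) : x ∈ convexHull ℝ s := by
  rw [convexHull_insert hs, mem_convexJoin] at hxs
  obtain ⟨_, rfl, u, hu, hxu⟩ := hxs
  by_contra hxs'
  exact hqI (mem_tightFace_of_mem_segment hq (convexHull_min hsP convex_polyhedron hu) hx hxu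
    (by rintro rfl; exact hxs' hu))

/-- Cells of the pulling triangulations of two faces meet in the hull of their common vertices.
If both faces have the same first point, the projections from it to the opposite facets agree;
otherwise the earlier of the two first points is not in the other face and can be dropped. -/
theorem PullingCell.convexHull_inter_subset [Fintype ι] [Finite κ] {I J : Set κ} {s t : Set (ι → ℝ)}
    (hs : PullingCell p (tightFace ℓ b I) s) (ht : PullingCell p (tightFace ℓ b J) t) :
    convexHull ℝ s ∩ convexHull ℝ t ⊆ convexHull ℝ (s ∩ t) := by
  generalize hF : tightFace ℓ b I = F at hs
  generalize hH : tightFace ℓ b J = H at ht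
  induction hs generalizing I J H t with
  | point i =>
    rintro x ⟨hxs, hxt⟩
    rw [convexHull_singleton, Set.mem_singleton_iff] at hxs
    subst hxs
    suffices h : p i ∈ t from subset_convexHull ℝ _ ⟨rfl, h⟩
    induction ht generalizing J with
    | point j => simpa using hxt
    | cone H G j t hj hG hjG ht ih =>
      subst hH
      obtain ⟨k, rfl, -⟩ := hG.eq_tightFace hj.1 hjG
      by_cases hij : p j = p i
      · exact Or.inl hij.symm
      · refine Or.inr (ih rfl (mem_convexHull_of_mem_insert ht.nonempty
          (ht.subset.trans tightFace_subset) hj.1.1 (I := I) ?_ ?_ hxt))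
        · rw [hF]; exact hij
        · rw [hF]; rfl
  | cone F G i s hi hG hiG hs ih =>
    subst hF
    obtain ⟨k, rfl, hk, -⟩ := hG.eq_tightFace hi.1 hiG
    have hsP : s ⊆ polyhedron ℓ b := hs.subset.trans tightFace_subset
    induction ht generalizing J with
    | point j =>
      rintro x ⟨hxs, hxt⟩
      rw [convexHull_singleton, Set.mem_singleton_iff] at hxt
      subst hxt
      by_cases hij : p j = p i
      · exact subset_convexHull ℝ _ ⟨Or.inl hij, rfl⟩
      · have h1 := mem_convexHull_of_mem_insert hs.nonempty hsP hi.1.1 (I := J)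
          (by rw [hH]; exact fun h => hij h.symm) (by rw [hH]; rfl) hxs
        exact convexHull_mono (Set.inter_subset_inter_left _ (Set.subset_insert _ _))
          (ih rfl {p j} hH (.point j) ⟨h1, by simp⟩)
    | cone H G j t hj hG' hjG ht ih' =>
      subst hH
      have hcell := PullingCell.cone _ G j t hj hG' hjG ht
      obtain ⟨m, rfl, hm, -⟩ := hG'.eq_tightFace hj.1 hjG
      have htP : t ⊆ polyhedron ℓ b := ht.subset.trans tightFace_subset
      rintro x ⟨hxs, hxt⟩
      have hxI : x ∈ tightFace ℓ b I :=
        (PullingCell.cone _ _ i s hi hG hiG hs).convexHull_subset hxs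
      have hxJ : x ∈ tightFace ℓ b J := hcell.convexHull_subset hxt
      rcases lt_trichotomy i j with hij | rfl | hij
      · have h1 := mem_convexHull_of_mem_insert hs.nonempty hsP hi.1.1 (hj.2 i hij) hxJ hxs
        exact convexHull_mono (Set.inter_subset_inter_left _ (Set.subset_insert _ _))
          (ih rfl _ rfl hcell ⟨h1, hxt⟩)
      · rw [convexHull_insert hs.nonempty, mem_convexJoin] at hxs
        rw [convexHull_insert ht.nonempty, mem_convexJoin] at hxt
        obtain ⟨_, rfl, u, hu, hxu⟩ := hxs
        obtain ⟨_, rfl, w, hw, hxw⟩ := hxt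
        have huG := hs.convexHull_subset hu
        have hwG := ht.convexHull_subset hw
        rw [segment_eq_image'] at hxu hxw
        obtain ⟨α, ⟨hα, hα1⟩, hαx⟩ := hxu
        obtain ⟨β, ⟨hβ, hβ1⟩, hβx⟩ := hxw
        have hsub : insert (p i) (s ∩ t) ⊆ insert (p i) s ∩ insert (p i) t :=
          Set.insert_subset ⟨Or.inl rfl, Or.inl rfl⟩
            (Set.inter_subset_inter (Set.subset_insert _ _) (Set.subset_insert _ _))
        have hpi : p i ∈ convexHull ℝ (insert (p i) s ∩ insert (p i) t) :=
          subset_convexHull ℝ _ (hsub (Or.inl rfl))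
        have key : ∀ (l : (ι → ℝ) →ₗ[ℝ] ℝ), α * (l u - l (p i)) = β * (l w - l (p i)) := by
          intro l
          have := congrArg l (hαx.trans hβx.symm)
          simpa using this
        have h1 := key (ℓ k)
        have h2 := key (ℓ m)
        have huk : ℓ k u = b k := huG.2 k (Set.mem_insert _ _)
        have hwm : ℓ m w = b m := hwG.2 m (Set.mem_insert _ _)
        have hwk := hwG.1 k
        have hum := huG.1 m
        -- the two projections agree, as each of the two facet inequalities is valid at both of them
        have hle1 : α ≤ β := by
          rw [huk] at h1
          nlinarith [mul_nonneg hβ (sub_nonneg.2 hwk)]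
        have hle2 : β ≤ α := by
          rw [hwm] at h2
          nlinarith [mul_nonneg hα (sub_nonneg.2 hum)]
        obtain rfl := le_antisymm hle1 hle2
        rcases hα.eq_or_lt with h0 | h0
        · rw [← hαx, ← h0]; simpa using hpi
        · have huw : u = w := by
            have h3 : α • (u - p i) = α • (w - p i) := by
              simpa using hαx.trans hβx.symm
            have h4 := smul_right_injective _ h0.ne' h3
            simpa using h4
          subst huw
          have h5 := convexHull_mono ((Set.subset_insert _ _).trans hsub)
            (ih rfl _ rfl ht ⟨hu, hw⟩)
          exact (convex_convexHull ℝ _).segment_subset hpi h5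
            (by rw [segment_eq_image']; exact ⟨α, ⟨hα, hα1⟩, hαx⟩)
      · have h1 := mem_convexHull_of_mem_insert ht.nonempty htP hj.1.1 (hi.2 j hij) hxI hxt
        exact convexHull_mono (Set.inter_subset_inter_right _ (Set.subset_insert _ _))
          (ih' rfl ⟨hxs, h1⟩)

theorem isTriangulation_pullingTriangulation [Fintype ι] [Finite κ]
    (hp : convexHull ℝ (Set.range p) = polyhedron ℓ b) :
    IsTriangulation (polyhedron ℓ b) (pullingTriangulation p (polyhedron ℓ b)) := by
  refine ⟨finite_pullingTriangulation _, ?_⟩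
  rw [← tightFace_empty (ℓ := ℓ) (b := b)]
  refine ⟨fun s hs => ⟨(Set.finite_range p).subset (PullingCell.subset_range hs),
    PullingCell.nonempty hs, PullingCell.affineIndependent hs⟩, ?_, fun s hs t ht => ?_⟩
  · refine Set.Subset.antisymm (Set.iUnion₂_subset fun s hs => PullingCell.convexHull_subset hs)
      fun x hx => ?_
    obtain ⟨s, hs, hxs⟩ := exists_pullingCell hp ∅ hx
    exact Set.mem_biUnion hs hxs
  · exact (PullingCell.convexHull_inter_subset hs ht).antisymm
      (Set.subset_inter (convexHull_mono Set.inter_subset_left)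
        (convexHull_mono Set.inter_subset_right))

/-! ### Polytopes of width one with respect to their facets -/

theorem sub_mem_latticePoints {ι : Type*} {x y : ι → ℝ} (hx : x ∈ latticePoints ι)
    (hy : y ∈ latticePoints ι) : x - y ∈ latticePoints ι := by
  obtain ⟨a, rfl⟩ := hx
  obtain ⟨c, rfl⟩ := hy
  exact ⟨a - c, by ext i; simp⟩

/-- The subgroup generated by the differences of the points of `s` with a point of `s` is generated
by all differences, hence does not depend on the point. -/
theorem closure_sub_image_eq {s : Set (ι → ℝ)} {v v' : ι → ℝ} (hv : v ∈ s) (hv' : v' ∈ s) :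
    AddSubgroup.closure ((fun w => w - v) '' s) = AddSubgroup.closure ((fun w => w - v') '' s) := by
  have key : ∀ {v v'}, v ∈ s → v' ∈ s →
      AddSubgroup.closure ((fun w => w - v) '' s) ≤
        AddSubgroup.closure ((fun w => w - v') '' s) := by
    intro v v' hv hv'
    rw [AddSubgroup.closure_le]
    rintro _ ⟨w, hw, rfl⟩
    have := AddSubgroup.sub_mem _
      (AddSubgroup.subset_closure (Set.mem_image_of_mem (fun w => w - v') hw))
      (AddSubgroup.subset_closure (Set.mem_image_of_mem (fun w => w - v') hv))
    simpa using this
  exact le_antisymm (key hv hv') (key hv' hv)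

theorem closure_sub_image_subset {s F : Set (ι → ℝ)} (hs : s ⊆ latticePoints ι) (hsF : s ⊆ F)
    {v : ι → ℝ} (hv : v ∈ s) :
    (AddSubgroup.closure ((fun w => w - v) '' s) : Set (ι → ℝ)) ⊆
      latticePoints ι ∩ (vectorSpan ℝ F : Set (ι → ℝ)) := by
  intro z hz
  induction hz using AddSubgroup.closure_induction with
  | mem z hz =>
    obtain ⟨w, hw, rfl⟩ := hz
    exact ⟨sub_mem_latticePoints (hs hw) (hs hv), vsub_mem_vectorSpan ℝ (hsF hw) (hsF hv)⟩
  | zero => exact ⟨⟨0, by ext; simp⟩, Submodule.zero_mem _⟩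
  | add x y _ _ hx hy =>
    obtain ⟨⟨a, rfl⟩, hx⟩ := hx
    obtain ⟨⟨c, rfl⟩, hy⟩ := hy
    exact ⟨⟨a + c, by ext; simp⟩, Submodule.add_mem _ hx hy⟩
  | neg x _ hx =>
    obtain ⟨⟨a, rfl⟩, hx⟩ := hx
    exact ⟨⟨-a, by ext; simp⟩, Submodule.neg_mem _ hx⟩

/-- If the inequalities are integral and no slack exceeds one, the vertices of a pulling cell
generate the lattice of its face: the apex has slack exactly one with respect to the opposite facet,
so subtracting an integer multiple of an edge at the apex moves any lattice vector into the
direction of that facet. -/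
theorem PullingCell.subset_closure [Fintype ι] [Finite κ] (hpL : Set.range p ⊆ latticePoints ι)
    (hint : ∀ k, ∀ z ∈ latticePoints ι, ∃ m : ℤ, ℓ k z = m)
    (hwidth : ∀ k, ∀ x ∈ polyhedron ℓ b, ℓ k x ≤ b k + 1) {I : Set κ} {s : Set (ι → ℝ)}
    (h : PullingCell p (tightFace ℓ b I) s) {v : ι → ℝ} (hv : v ∈ s) :
    latticePoints ι ∩ (vectorSpan ℝ (tightFace ℓ b I) : Set (ι → ℝ)) ⊆
      AddSubgroup.closure ((fun w => w - v) '' s) := by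
  generalize hF : tightFace ℓ b I = F at h
  induction h generalizing I v with
  | point i =>
    rintro z ⟨-, hz⟩
    rw [vectorSpan_singleton] at hz
    rw [show z = 0 from hz]
    exact AddSubgroup.zero_mem _
  | cone F G i s hi hG hiG hs ih =>
    subst hF
    obtain ⟨k, rfl, hk, hspan⟩ := hG.eq_tightFace hi.1 hiG
    obtain ⟨v', hv'⟩ := hs.nonempty
    rw [closure_sub_image_eq hv (Set.mem_insert_of_mem (p i) hv')]
    have hpi : p i ∈ latticePoints ι := hpL ⟨i, rfl⟩
    have hv'L := hpL (hs.subset_range hv')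
    have hv'k : ℓ k v' = b k := (hs.subset hv').2 k (Set.mem_insert _ _)
    have hone : ℓ k (p i - v') = 1 := by
      obtain ⟨m, hm⟩ := hint k _ (sub_mem_latticePoints hpi hv'L)
      have h1 := hwidth k _ hi.1.1
      have h2 : ℓ k (p i - v') = ℓ k (p i) - b k := by rw [map_sub, hv'k]
      have h3 : (0 : ℝ) < m := by rw [← hm, h2]; linarith
      have h4 : (m : ℝ) ≤ 1 := by rw [← hm, h2]; linarith
      have h5 : m = 1 := le_antisymm (by exact_mod_cast h4) (by exact_mod_cast h3)
      rw [hm, h5, Int.cast_one]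
    rintro z ⟨hzL, hzD⟩
    obtain ⟨m, hm⟩ := hint k z hzL
    have hmem : z - m • (p i - v') ∈
        latticePoints ι ∩ (vectorSpan ℝ (tightFace ℓ b (insert k I)) : Set (ι → ℝ)) := by
      have hedge := sub_mem_latticePoints hpi hv'L
      refine ⟨sub_mem_latticePoints hzL ?_, ?_⟩
      · obtain ⟨a, ha⟩ := hedge
        exact ⟨m • a, by rw [← ha]; ext; simp⟩
      · rw [hspan]
        refine ⟨Submodule.sub_mem _ hzD ?_, ?_⟩
        · rw [← Int.cast_smul_eq_zsmul ℝ]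
          exact Submodule.smul_mem _ _
            (vsub_mem_vectorSpan ℝ hi.1 (hG.2.1.subset (hs.subset hv')))
        · rw [SetLike.mem_coe, LinearMap.mem_ker, map_sub, map_zsmul, hone, hm]; simp
    have h1 := ih hv' rfl hmem
    have h2 := AddSubgroup.closure_mono (Set.image_mono (Set.subset_insert (p i) s)) h1
    have h3 : p i - v' ∈ AddSubgroup.closure ((fun w => w - v') '' insert (p i) s) :=
      AddSubgroup.subset_closure ⟨p i, Set.mem_insert _ _, rfl⟩
    have h4 := AddSubgroup.add_mem _ h2 (AddSubgroup.zsmul_mem _ h3 m)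
    rwa [sub_add_cancel] at h4

/-- Every pulling triangulation of a lattice polytope that has width at most one in the direction of
each inequality of an integral description is unimodular. -/
theorem isUnimodularTriangulation_pullingTriangulation [Fintype ι] [Finite κ]
    (hint : ∀ k, ∀ z ∈ latticePoints ι, ∃ m : ℤ, ℓ k z = m)
    (hwidth : ∀ k, ∀ x ∈ polyhedron ℓ b, ℓ k x ≤ b k + 1)
    (hp : IsPullingOrder (polyhedron ℓ b) p) :
    IsUnimodularTriangulation (polyhedron ℓ b) (pullingTriangulation p (polyhedron ℓ b)) := by
  obtain ⟨-, hL, hP⟩ := hp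
  have htri := isTriangulation_pullingTriangulation hP
  refine ⟨htri, fun s hs => ?_⟩
  have hsL : s ⊆ latticePoints ι := (PullingCell.subset_range hs).trans hL
  refine ⟨(htri.2.1 s hs).2.1, hsL, (htri.2.1 s hs).2.2, fun v hv => ?_⟩
  refine (closure_sub_image_subset hsL (PullingCell.subset hs) hv).antisymm ?_
  have hs' : PullingCell p (tightFace ℓ b ∅) s := by rw [tightFace_empty]; exact hs
  have := hs'.subset_closure hL hint hwidth hv
  rwa [tightFace_empty] at this

end Pulling

/-! ### Vertices of polyhedra -/

section Vertices

variable {ι κ : Type*} {ℓ : κ → (ι → ℝ) →ₗ[ℝ] ℝ} {b : κ → ℝ}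

/-- If all inequalities that are tight at a vertex are tight at a second point of the polyhedron,
then this point is the vertex: otherwise the segment between them can be prolonged beyond the
vertex. -/
theorem eq_of_mem_extremePoints_of_tight [Finite κ] {x v : ι → ℝ}
    (hx : x ∈ (polyhedron ℓ b).extremePoints ℝ) (hv : v ∈ polyhedron ℓ b)
    (h : ∀ k, ℓ k x = b k → ℓ k v = b k) : v = x := by
  obtain ⟨ε, hε, hεk⟩ := exists_pos_mul_abs_le (fun k => ℓ k x - b k) (fun k => ℓ k x - ℓ k v)
  have hz : x + ε • (x - v) ∈ polyhedron ℓ b := by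
    intro k
    simp only [map_add, map_smul, map_sub, smul_eq_mul]
    rcases (hx.1 k).eq_or_lt with hk | hk
    · rw [← hk, h k hk.symm]; simp
    · have h1 := hεk k (sub_pos.2 hk)
      have h2 := mul_le_mul_of_nonneg_left (neg_abs_le (ℓ k x - ℓ k v)) hε.le
      linarith
  refine hx.2 hv hz ⟨ε / (1 + ε), 1 / (1 + ε), by positivity, by positivity, by field_simp; ring, ?_⟩
  ext i
  simp only [Pi.add_apply, Pi.smul_apply, Pi.sub_apply, smul_eq_mul]
  field_simp
  ring

end Vertices

/-! ### Runner-up consistent score sheets -/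

section Sheets

variable {n : ℕ}

/-- The inequalities of runner-up consistency for a real vector. -/
structure IsRunnerUpVector (x : Pos n → ℝ) : Prop where
  nonneg : ∀ e, 0 ≤ x e
  anti : ∀ i j, i ≤ j → goals x Finset.univ j ≤ goals x Finset.univ i
  anti' : ∀ i ∈ nonLeaders n, ∀ j ∈ nonLeaders n, i ≤ j →
    goals x (nonLeaders n) j ≤ goals x (nonLeaders n) i

theorem mem_nonLeaders {i : Fin n} : i ∈ nonLeaders n ↔ i.val ≠ 0 := by simp [nonLeaders]

theorem goals_toReal (S : Pos n → ℕ) (K : Finset (Fin n)) (i : Fin n) :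
    goals (toReal S) K i = ((goals S K i : ℕ) : ℝ) := by
  simp [goals, toReal]

theorem isRunnerUpVector_toReal {S : Pos n → ℕ} :
    IsRunnerUpVector (toReal S) ↔ S ∈ runnerUpConsistent n := by
  constructor
  · intro h
    refine ⟨fun i _ j _ hij => ?_, fun i hi j hj hij => ?_⟩
    · have := h.anti i j hij
      rw [goals_toReal, goals_toReal] at this
      exact_mod_cast this
    · have := h.anti' i hi j hj hij
      rw [goals_toReal, goals_toReal] at this
      exact_mod_cast this
  · intro h
    refine ⟨fun e => Nat.cast_nonneg _, fun i j hij => ?_, fun i hi j hj hij => ?_⟩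
    · rw [goals_toReal, goals_toReal]
      exact_mod_cast h.1 i (Finset.mem_univ i) j (Finset.mem_univ j) hij
    · rw [goals_toReal, goals_toReal]
      exact_mod_cast h.2 i hi j hj hij

theorem leaderGoals_eq_goals (x : Pos n → ℝ) {i : Fin n} (hi : i.val = 0) :
    leaderGoals x = goals x Finset.univ i := by
  unfold leaderGoals goals
  congr 1
  ext e
  simp [Fin.ext_iff, hi]

theorem goals_nonneg {x : Pos n → ℝ} (hx : ∀ e, 0 ≤ x e) (K : Finset (Fin n)) (i : Fin n) :
    0 ≤ goals x K i :=
  Finset.sum_nonneg fun e _ => hx e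

theorem goals_le_goals_univ {x : Pos n → ℝ} (hx : ∀ e, 0 ≤ x e) (K : Finset (Fin n)) (i : Fin n) :
    goals x K i ≤ goals x Finset.univ i :=
  Finset.sum_le_sum_of_subset_of_nonneg
    (fun e he => by simp only [Finset.mem_filter] at he ⊢; exact ⟨he.1, he.2.1, Finset.mem_univ _⟩)
    fun e _ _ => hx e

theorem le_goals_univ {x : Pos n → ℝ} (hx : ∀ e, 0 ≤ x e) (e : Pos n) :
    x e ≤ goals x Finset.univ e.1.1 :=
  Finset.single_le_sum (f := x) (fun e _ => hx e) (by simp)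

theorem exists_pos_of_goals_pos {x : Pos n → ℝ} {K : Finset (Fin n)} {i : Fin n}
    (h : 0 < goals x K i) : ∃ j, ∃ hij : i ≠ j, j ∈ K ∧ 0 < x ⟨(i, j), hij⟩ := by
  obtain ⟨e, he, hxe⟩ := Finset.exists_lt_of_sum_lt (s := Finset.univ.filter
    fun e : Pos n => e.1.1 = i ∧ e.1.2 ∈ K) (f := fun _ => (0 : ℝ)) (g := x)
    (by rw [Finset.sum_const_zero]; exact h)
  obtain ⟨⟨a, c⟩, hac⟩ := e
  simp only [Finset.mem_filter, Finset.mem_univ, true_and] at he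
  obtain ⟨rfl, hc⟩ := he
  exact ⟨c, hac, hc, hxe⟩

/-- The goals of a team outside of a set of opponents were scored against some other opponent. -/
theorem exists_pos_of_goals_lt {x : Pos n → ℝ} {i : Fin n}
    (h : goals x (nonLeaders n) i < goals x Finset.univ i) :
    ∃ j, ∃ hij : i ≠ j, j ∉ nonLeaders n ∧ 0 < x ⟨(i, j), hij⟩ := by
  have hsplit : goals x Finset.univ i =
      goals x (nonLeaders n) i + goals x (nonLeaders n)ᶜ i := by
    unfold goals
    rw [← Finset.sum_union]
    · congr 1
      ext e
      simp only [Finset.mem_filter, Finset.mem_union, Finset.mem_univ, Finset.mem_compl]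
      tauto
    · rw [Finset.disjoint_filter]
      intro e _ h1 h2
      exact Finset.mem_compl.1 h2.2 h1.2
  obtain ⟨j, hij, hj, hpos⟩ := exists_pos_of_goals_pos (K := (nonLeaders n)ᶜ) (x := x) (i := i)
    (by linarith)
  exact ⟨j, hij, Finset.mem_compl.1 hj, hpos⟩

/-- The score sheet in which each team `i ∈ A` scores one goal, against the team `f i`, and the
other teams score no goal. -/
noncomputable def singleGoalSheet (A : Set (Fin n)) (f : Fin n → Fin n) : Pos n → ℕ :=
  open Classical in fun e => if e.1.1 ∈ A ∧ e.1.2 = f e.1.1 then 1 else 0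

open Classical in
theorem goals_singleGoalSheet {A : Set (Fin n)} {f : Fin n → Fin n} (hf : ∀ i ∈ A, i ≠ f i)
    (K : Finset (Fin n)) (i : Fin n) :
    goals (singleGoalSheet A f) K i = if i ∈ A ∧ f i ∈ K then 1 else 0 := by
  unfold goals singleGoalSheet
  split_ifs with h
  · rw [Finset.sum_eq_single_of_mem ⟨(i, f i), hf i h.1⟩ (by simp [h.2])]
    · simp [h.1]
    · rintro ⟨⟨a, c⟩, hac⟩ he hne
      simp only [Finset.mem_filter, Finset.mem_univ, true_and] at he
      refine if_neg fun h' => hne ?_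
      obtain ⟨rfl, -⟩ := he
      exact Subtype.ext (Prod.ext rfl h'.2)
  · refine Finset.sum_eq_zero fun e he => if_neg fun h' => h ?_
    simp only [Finset.mem_filter, Finset.mem_univ, true_and] at he
    exact ⟨he.1 ▸ h'.1, by rw [← he.1, ← h'.2]; exact he.2⟩

/-- For each runner-up consistent vector in which the leader team scores, there is a runner-up
consistent score sheet with one goal of the leader team at which all inequalities are tight that
are tight at the vector. One goal is given to each team that scores as many goals as the leader
team. The teams `B` that are to score theirs not against the leader team are those that tie with the
runner-up after the deletion of the leader team, unless this would separate two tied teams. -/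
theorem exists_singleGoalSheet (hn : 2 ≤ n) {x : Pos n → ℝ} (hx : IsRunnerUpVector x)
    (hpos : 0 < leaderGoals x) :
    ∃ S ∈ runnerUpConsistent n, leaderGoals (toReal S) = 1 ∧ (∀ e, x e = 0 → S e = 0) ∧
      (∀ i j, goals x Finset.univ i = goals x Finset.univ j →
        goals S Finset.univ i = goals S Finset.univ j) ∧
      (∀ i ∈ nonLeaders n, ∀ j ∈ nonLeaders n,
        goals x (nonLeaders n) i = goals x (nonLeaders n) j →
          goals S (nonLeaders n) i = goals S (nonLeaders n) j) := by
  classical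
  let t₀ : Fin n := ⟨0, by omega⟩
  let t₁ : Fin n := ⟨1, by omega⟩
  have ht₁ : t₁ ∈ nonLeaders n := by simp [mem_nonLeaders, t₁]
  have hle₁ : ∀ i ∈ nonLeaders n, t₁ ≤ i := fun i hi => by
    rw [mem_nonLeaders] at hi
    exact Fin.le_def.2 (by simp only [t₁]; omega)
  have h0 : ∀ i : Fin n, t₀ ≤ i := fun i => Fin.le_def.2 (by simp [t₀])
  rw [leaderGoals_eq_goals x (i := t₀) rfl] at hpos
  set g : Fin n → ℝ := goals x Finset.univ with hg
  set g' : Fin n → ℝ := goals x (nonLeaders n) with hg'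
  have hg'g : ∀ i, g' i ≤ g i := goals_le_goals_univ hx.nonneg _
  let A : Set (Fin n) := {i | g i = g t₀}
  let B : Set (Fin n) := {i | g' i = g' t₁ ∧ 0 < g' t₁ ∧ ∀ m ∈ nonLeaders n, g' m = g' t₁ → m ∈ A}
  have hBA : ∀ i ∈ nonLeaders n, i ∈ B → i ∈ A := fun i hi hB => hB.2.2 i hi hB.1
  have hchoice : ∀ i, ∃ j, i ∈ A → ∃ hij : i ≠ j, 0 < x ⟨(i, j), hij⟩ ∧
      (i ∈ nonLeaders n → (j ∈ nonLeaders n ↔ i ∈ B)) := by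
    intro i
    by_cases hA : i ∈ A
    swap
    · exact ⟨i, fun h => absurd h hA⟩
    have hgi : g i = g t₀ := hA
    by_cases hi : i ∈ nonLeaders n
    swap
    · obtain ⟨j, hij, -, hj⟩ := exists_pos_of_goals_pos (x := x) (K := Finset.univ) (i := i)
        (show 0 < g i by rw [hgi]; exact hpos)
      exact ⟨j, fun _ => ⟨hij, hj, fun h => absurd h hi⟩⟩
    by_cases hB : i ∈ B
    · obtain ⟨j, hij, hjK, hj⟩ := exists_pos_of_goals_pos (x := x) (K := nonLeaders n) (i := i)
        (show 0 < g' i by rw [hB.1]; exact hB.2.1)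
      exact ⟨j, fun _ => ⟨hij, hj, fun _ => iff_of_true hjK hB⟩⟩
    · have hlt : g' i < g i := by
        have hi1 : g' i ≤ g' t₁ := hx.anti' t₁ ht₁ i hi (hle₁ i hi)
        by_cases hc : 0 < g' t₁
        · by_cases hm : ∀ m ∈ nonLeaders n, g' m = g' t₁ → m ∈ A
          · have h1 : g t₁ = g t₀ := hm t₁ ht₁ rfl
            have h2 : g' i ≠ g' t₁ := fun h => hB ⟨h, hc, hm⟩
            calc g' i < g' t₁ := lt_of_le_of_ne hi1 h2
              _ ≤ g t₁ := hg'g t₁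
              _ = g i := by rw [h1, hgi]
          · push Not at hm
            obtain ⟨m, -, hm1, hmA⟩ := hm
            calc g' i ≤ g' t₁ := hi1
              _ = g' m := hm1.symm
              _ ≤ g m := hg'g m
              _ < g t₀ := lt_of_le_of_ne (hx.anti _ _ (h0 m)) hmA
              _ = g i := hgi.symm
        · linarith
      obtain ⟨j, hij, hjK, hj⟩ := exists_pos_of_goals_lt hlt
      exact ⟨j, fun _ => ⟨hij, hj, fun _ => iff_of_false hjK hB⟩⟩
  choose f hf using hchoice
  have hfA : ∀ i ∈ A, i ≠ f i := fun i hi => (hf i hi).1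
  have hgoals : ∀ i, goals (singleGoalSheet A f) Finset.univ i = if i ∈ A then 1 else 0 := by
    intro i; simp [goals_singleGoalSheet hfA]
  have hgoals' : ∀ i ∈ nonLeaders n,
      goals (singleGoalSheet A f) (nonLeaders n) i = if i ∈ B then 1 else 0 := by
    intro i hi
    rw [goals_singleGoalSheet hfA]
    refine if_congr ⟨fun h => ?_, fun h => ?_⟩ rfl rfl
    · exact ((hf i h.1).2.2 hi).1 h.2
    · have hA := hBA i hi h
      exact ⟨hA, ((hf i hA).2.2 hi).2 h⟩
  refine ⟨singleGoalSheet A f, ⟨fun i _ j _ hij => ?_, fun i hi j hj hij => ?_⟩, ?_, ?_, ?_, ?_⟩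
  · rw [hgoals, hgoals]
    have : j ∈ A → i ∈ A := fun h =>
      le_antisymm (hx.anti _ _ (h0 i)) ((show g j = g t₀ from h) ▸ hx.anti i j hij)
    split_ifs <;> simp_all
  · rw [hgoals' i hi, hgoals' j hj]
    have : j ∈ B → i ∈ B := fun h =>
      ⟨le_antisymm (hx.anti' t₁ ht₁ i hi (hle₁ i hi)) (h.1 ▸ hx.anti' i hi j hj hij), h.2⟩
    split_ifs <;> simp_all
  · rw [leaderGoals_eq_goals _ (i := t₀) rfl, goals_toReal, hgoals,
      if_pos (show t₀ ∈ A from rfl), Nat.cast_one]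
  · rintro ⟨⟨i, j⟩, hij⟩ he
    refine if_neg ?_
    rintro ⟨hA, hj⟩
    obtain ⟨h1, h2, -⟩ := hf i hA
    simp only at hj
    subst hj
    exact h2.ne' he
  · intro i j hij
    rw [hgoals, hgoals]
    exact if_congr (by change g i = g t₀ ↔ g j = g t₀; rw [hij]) rfl rfl
  · intro i hi j hj hij
    rw [hgoals' i hi, hgoals' j hj]
    refine if_congr ?_ rfl rfl
    change (g' i = _ ∧ _) ↔ (g' j = _ ∧ _)
    rw [hij]

/-! ### The polytope of runner-up consistent score sheets -/

/-- The number of goals that team `i` scored against the teams in `K`, as a linear form. -/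
def goalsForm (K : Finset (Fin n)) (i : Fin n) : (Pos n → ℝ) →ₗ[ℝ] ℝ :=
  ∑ e : Pos n with e.1.1 = i ∧ e.1.2 ∈ K, LinearMap.proj e

theorem goalsForm_apply (K : Finset (Fin n)) (i : Fin n) (x : Pos n → ℝ) :
    goalsForm K i x = goals x K i := by
  simp [goalsForm, goals]

/-- Indices for the inequalities that describe the polytope: one for each position, one for each
pair of teams `i ≤ j`, one for each such pair of teams other than the leader team, and two for the
equation `g₁ = 1`. -/
abbrev SheetIndex (n : ℕ) : Type :=
  Pos n ⊕ {q : Fin n × Fin n // q.1 ≤ q.2} ⊕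
    {q : Fin n × Fin n // q.1 ∈ nonLeaders n ∧ q.2 ∈ nonLeaders n ∧ q.1 ≤ q.2} ⊕ Bool

/-- The left-hand sides of the inequalities that describe the polytope. -/
def sheetForm (n : ℕ) : SheetIndex n → (Pos n → ℝ) →ₗ[ℝ] ℝ
  | .inl e => LinearMap.proj e
  | .inr (.inl q) => goalsForm Finset.univ q.1.1 - goalsForm Finset.univ q.1.2
  | .inr (.inr (.inl q)) => goalsForm (nonLeaders n) q.1.1 - goalsForm (nonLeaders n) q.1.2
  | .inr (.inr (.inr true)) => ∑ e : Pos n with e.1.1.val = 0, LinearMap.proj e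
  | .inr (.inr (.inr false)) => -∑ e : Pos n with e.1.1.val = 0, LinearMap.proj e

/-- The right-hand sides of the inequalities that describe the polytope. -/
def sheetBound (n : ℕ) : SheetIndex n → ℝ
  | .inr (.inr (.inr true)) => 1
  | .inr (.inr (.inr false)) => -1
  | _ => 0

theorem mem_polyhedron_sheetForm {x : Pos n → ℝ} :
    x ∈ polyhedron (sheetForm n) (sheetBound n) ↔ IsRunnerUpVector x ∧ leaderGoals x = 1 := by
  have hl : (∑ e : Pos n with e.1.1.val = 0, LinearMap.proj e : (Pos n → ℝ) →ₗ[ℝ] ℝ) x =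
      leaderGoals x := by simp [leaderGoals]
  constructor
  · intro h
    refine ⟨⟨fun e => h (.inl e), fun i j hij => ?_, fun i hi j hj hij => ?_⟩,
      le_antisymm ?_ ?_⟩
    · have := h (.inr (.inl ⟨(i, j), hij⟩))
      simpa [sheetForm, sheetBound, goalsForm_apply] using this
    · have := h (.inr (.inr (.inl ⟨(i, j), hi, hj, hij⟩)))
      simpa [sheetForm, sheetBound, goalsForm_apply] using this
    · have := h (.inr (.inr (.inr false)))
      rw [sheetForm, LinearMap.neg_apply, hl] at this
      exact neg_le_neg_iff.1 this
    · have := h (.inr (.inr (.inr true)))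
      rwa [sheetForm, hl] at this
  · rintro ⟨h, h1⟩ (e | ⟨q, hq⟩ | ⟨q, hq⟩ | _ | _)
    · exact h.nonneg e
    · simpa [sheetForm, sheetBound, goalsForm_apply] using h.anti _ _ hq
    · simpa [sheetForm, sheetBound, goalsForm_apply] using h.anti' _ hq.1 _ hq.2.1 hq.2.2
    · rw [sheetForm, LinearMap.neg_apply, hl, h1, sheetBound]
    · rw [sheetForm, hl, h1, sheetBound]

/-- In a runner-up consistent vector, no team scores more than the leader team. -/
theorem IsRunnerUpVector.goals_le {x : Pos n → ℝ} (hx : IsRunnerUpVector x) (K : Finset (Fin n))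
    (i : Fin n) : goals x K i ≤ leaderGoals x := by
  rw [leaderGoals_eq_goals x (i := ⟨0, i.pos⟩) rfl]
  exact (goals_le_goals_univ hx.nonneg K i).trans (hx.anti _ _ (Fin.le_def.2 (Nat.zero_le _)))

theorem IsRunnerUpVector.le_leaderGoals {x : Pos n → ℝ} (hx : IsRunnerUpVector x) (e : Pos n) :
    x e ≤ leaderGoals x :=
  (le_goals_univ hx.nonneg e).trans (hx.goals_le _ _)

theorem sheetForm_integral (k : SheetIndex n) {z : Pos n → ℝ} (hz : z ∈ latticePoints (Pos n)) :
    ∃ m : ℤ, sheetForm n k z = m := by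
  obtain ⟨a, rfl⟩ := hz
  have hg : ∀ (K : Finset (Fin n)) i, goals (fun e => (a e : ℝ)) K i = ((goals a K i : ℤ) : ℝ) := by
    intro K i; simp [goals]
  rcases k with e | ⟨q, hq⟩ | ⟨q, hq⟩ | _ | _
  · exact ⟨a e, rfl⟩
  · exact ⟨goals a Finset.univ q.1 - goals a Finset.univ q.2, by
      simp [sheetForm, goalsForm_apply, hg]⟩
  · exact ⟨goals a (nonLeaders n) q.1 - goals a (nonLeaders n) q.2, by
      simp [sheetForm, goalsForm_apply, hg]⟩
  · exact ⟨-∑ e : Pos n with e.1.1.val = 0, a e, by simp [sheetForm]⟩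
  · exact ⟨∑ e : Pos n with e.1.1.val = 0, a e, by simp [sheetForm]⟩

/-- All entries and all numbers of goals are at most `g₁ = 1`, so all slacks are at most one. -/
theorem sheetForm_le (k : SheetIndex n) {x : Pos n → ℝ}
    (hx : x ∈ polyhedron (sheetForm n) (sheetBound n)) :
    sheetForm n k x ≤ sheetBound n k + 1 := by
  obtain ⟨h, h1⟩ := mem_polyhedron_sheetForm.1 hx
  have hl : (∑ e : Pos n with e.1.1.val = 0, LinearMap.proj e : (Pos n → ℝ) →ₗ[ℝ] ℝ) x = 1 := by
    rw [← h1]; simp [leaderGoals]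
  have hg : ∀ K i j, goals x K i - goals x K j ≤ 1 := fun K i j => by
    have h2 := h.goals_le K i
    have h3 := goals_nonneg h.nonneg K j
    linarith
  rcases k with e | ⟨q, hq⟩ | ⟨q, hq⟩ | _ | _
  · simpa [sheetForm, sheetBound, h1] using h.le_leaderGoals e
  · simpa [sheetForm, sheetBound, goalsForm_apply] using hg _ _ _
  · simpa [sheetForm, sheetBound, goalsForm_apply] using hg _ _ _
  · rw [sheetForm, LinearMap.neg_apply, hl, sheetBound]; norm_num
  · rw [sheetForm, hl, sheetBound]; norm_num

/-- The runner-up consistent score sheets with one goal of the leader team, as real vectors. -/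
def leaderSheets (n : ℕ) : Set (Pos n → ℝ) :=
  toReal '' {S | S ∈ runnerUpConsistent n ∧ leaderGoals (toReal S) = 1}

theorem finite_leaderSheets : (leaderSheets n).Finite := by
  refine Set.Finite.image _ ((Set.finite_Iic (1 : Pos n → ℕ)).subset ?_)
  rintro S ⟨hS, h1⟩ e
  have := (isRunnerUpVector_toReal.2 hS).le_leaderGoals e
  rw [h1] at this
  exact Nat.cast_le_one.1 this

theorem leaderSheets_subset_latticePoints : leaderSheets n ⊆ latticePoints (Pos n) := by
  rintro _ ⟨S, -, rfl⟩
  exact ⟨fun e => (S e : ℤ), by ext e; simp [toReal]⟩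

/-- By the theorem of Krein and Milman, since every vertex is a score sheet. -/
theorem polyhedron_sheetForm_eq_convexHull (hn : 2 ≤ n) :
    polyhedron (sheetForm n) (sheetBound n) = convexHull ℝ (leaderSheets n) := by
  have hsub : leaderSheets n ⊆ polyhedron (sheetForm n) (sheetBound n) := by
    rintro _ ⟨S, ⟨hS, h1⟩, rfl⟩
    exact mem_polyhedron_sheetForm.2 ⟨isRunnerUpVector_toReal.2 hS, h1⟩
  refine Set.Subset.antisymm ?_ (convexHull_min hsub convex_polyhedron)
  have hcompact : IsCompact (polyhedron (sheetForm n) (sheetBound n)) := by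
    refine (isCompact_Icc (a := (0 : Pos n → ℝ)) (b := 1)).of_isClosed_subset ?_ fun x hx => ?_
    · have : polyhedron (sheetForm n) (sheetBound n) =
          ⋂ k, {x | sheetBound n k ≤ sheetForm n k x} := by ext x; simp [polyhedron]
      rw [this]
      exact isClosed_iInter fun k =>
        isClosed_le continuous_const (LinearMap.continuous_of_finiteDimensional _)
    · obtain ⟨h, h1⟩ := mem_polyhedron_sheetForm.1 hx
      exact ⟨h.nonneg, fun e => (h.le_leaderGoals e).trans_eq h1⟩
  rw [← closure_convexHull_extremePoints hcompact convex_polyhedron]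
  refine closure_minimal (convexHull_mono fun x hx => ?_)
    (finite_leaderSheets.isCompact_convexHull ℝ).isClosed
  obtain ⟨h, h1⟩ := mem_polyhedron_sheetForm.1 hx.1
  obtain ⟨S, hS, hS1, hS0, hSg, hSg'⟩ := exists_singleGoalSheet hn h (by rw [h1]; norm_num)
  refine ⟨S, ⟨hS, hS1⟩, eq_of_mem_extremePoints_of_tight hx
    (hsub ⟨S, ⟨hS, hS1⟩, rfl⟩) fun k hk => ?_⟩
  have hSmem := mem_polyhedron_sheetForm.2 ⟨isRunnerUpVector_toReal.2 hS, hS1⟩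
  rcases k with e | ⟨q, hq⟩ | ⟨q, hq⟩ | _ | _
  · exact (congrArg (Nat.cast (R := ℝ)) (hS0 e hk)).trans Nat.cast_zero
  · simp only [sheetForm, sheetBound, LinearMap.sub_apply, goalsForm_apply, sub_eq_zero,
      goals_toReal, Nat.cast_inj] at hk ⊢
    exact hSg _ _ hk
  · simp only [sheetForm, sheetBound, LinearMap.sub_apply, goalsForm_apply, sub_eq_zero,
      goals_toReal, Nat.cast_inj] at hk ⊢
    exact hSg' _ hq.1 _ hq.2.1 hk
  -- the two inequalities that make up the equation `g₁ = 1` are tight everywhere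
  · refine le_antisymm ?_ (hSmem _)
    have := hSmem (.inr (.inr (.inr true)))
    simp only [sheetForm, sheetBound, LinearMap.neg_apply] at this ⊢
    linarith
  · refine le_antisymm ?_ (hSmem _)
    have := hSmem (.inr (.inr (.inr false)))
    simp only [sheetForm, sheetBound, LinearMap.neg_apply] at this ⊢
    linarith

theorem goals_real_add (x y : Pos n → ℝ) (K : Finset (Fin n)) (i : Fin n) :
    goals (x + y) K i = goals x K i + goals y K i := by
  simp [goals, Finset.sum_add_distrib]

theorem goals_smul (c : ℝ) (x : Pos n → ℝ) (K : Finset (Fin n)) (i : Fin n) :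
    goals (c • x) K i = c * goals x K i := by
  simp [goals, Finset.mul_sum]

theorem IsRunnerUpVector.add {x y : Pos n → ℝ} (hx : IsRunnerUpVector x)
    (hy : IsRunnerUpVector y) : IsRunnerUpVector (x + y) where
  nonneg e := add_nonneg (hx.nonneg e) (hy.nonneg e)
  anti i j hij := by
    rw [goals_real_add, goals_real_add]
    exact add_le_add (hx.anti i j hij) (hy.anti i j hij)
  anti' i hi j hj hij := by
    rw [goals_real_add, goals_real_add]
    exact add_le_add (hx.anti' i hi j hj hij) (hy.anti' i hi j hj hij)

theorem IsRunnerUpVector.smul {x : Pos n → ℝ} (hx : IsRunnerUpVector x) {c : ℝ} (hc : 0 ≤ c) :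
    IsRunnerUpVector (c • x) where
  nonneg e := mul_nonneg hc (hx.nonneg e)
  anti i j hij := by
    rw [goals_smul, goals_smul]
    exact mul_le_mul_of_nonneg_left (hx.anti i j hij) hc
  anti' i hi j hj hij := by
    rw [goals_smul, goals_smul]
    exact mul_le_mul_of_nonneg_left (hx.anti' i hi j hj hij) hc

theorem isRunnerUpVector_of_mem_runnerUpCone {x : Pos n → ℝ} (hx : x ∈ runnerUpCone n) :
    IsRunnerUpVector x := by
  induction hx using Submodule.span_induction with
  | mem x hx =>
    obtain ⟨S, hS, rfl⟩ := hx
    exact isRunnerUpVector_toReal.2 hS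
  | zero =>
    have := isRunnerUpVector_toReal.2 (runnerUpConsistent n).zero_mem
    rwa [show toReal (0 : Pos n → ℕ) = 0 by ext; simp [toReal]] at this
  | add x y _ _ hx hy => exact hx.add hy
  | smul c x _ hx => exact hx.smul c.2

theorem runnerUpPolytope_eq_polyhedron (hn : 2 ≤ n) :
    runnerUpPolytope n = polyhedron (sheetForm n) (sheetBound n) := by
  refine Set.Subset.antisymm (fun x hx => mem_polyhedron_sheetForm.2
    ⟨isRunnerUpVector_of_mem_runnerUpCone hx.1, hx.2⟩) fun x hx => ?_
  refine ⟨?_, (mem_polyhedron_sheetForm.1 hx).2⟩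
  rw [polyhedron_sheetForm_eq_convexHull hn] at hx
  refine convexHull_min ?_ (runnerUpCone n).convex hx
  rintro _ ⟨S, hS, rfl⟩
  exact PointedCone.subset_hull ⟨S, hS.1, rfl⟩

/-! ### The Hilbert basis and integral closedness -/

/-- A nonzero runner-up consistent score sheet remains one after the subtraction of a suitable sheet
with one goal of the leader team: an inequality that is not tight has an integral slack of at least
one, and the subtraction decreases it by at most one. -/
theorem exists_eq_add_of_ne_zero (hn : 2 ≤ n) {S : Pos n → ℕ} (hS : S ∈ runnerUpConsistent n)
    (hS0 : S ≠ 0) :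
    ∃ T ∈ runnerUpConsistent n, leaderGoals (toReal T) = 1 ∧
      ∃ U ∈ runnerUpConsistent n, S = T + U := by
  have hx := isRunnerUpVector_toReal.2 hS
  have hpos : 0 < leaderGoals (toReal S) := by
    obtain ⟨e, he⟩ := Function.ne_iff.1 hS0
    have h1 : (0 : ℝ) < toReal S e := Nat.cast_pos.2 (Nat.pos_of_ne_zero he)
    exact h1.trans_le (hx.le_leaderGoals e)
  obtain ⟨T, hT, hT1, hTe, hTg, hTg'⟩ := exists_singleGoalSheet hn hx hpos
  have hTx := isRunnerUpVector_toReal.2 hT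
  have hle : T ≤ S := by
    intro e
    have h1 := hTx.le_leaderGoals e
    rw [hT1] at h1
    have h1' : T e ≤ 1 := Nat.cast_le_one.1 h1
    by_cases h : S e = 0
    · rw [hTe e (by simp [toReal, h])]; exact Nat.zero_le _
    · change T e ≤ S e
      omega
  have hle1 : ∀ K i, goals T K i ≤ 1 := by
    intro K i
    have := hTx.goals_le K i
    rw [hT1, goals_toReal] at this
    exact_mod_cast this
  have hsum : S = T + (S - T) := (add_tsub_cancel_of_le hle).symm
  have hgoals : ∀ K i, goals S K i = goals T K i + goals (S - T) K i := fun K i => by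
    conv_lhs => rw [hsum]
    exact goals_add _ _ _ _
  refine ⟨T, hT, hT1, S - T, ⟨fun i hi j hj hij => ?_, fun i hi j hj hij => ?_⟩, hsum⟩
  · have h1 := hS.1 i hi j hj hij
    have h2 := hTg i j
    rw [goals_toReal, goals_toReal, Nat.cast_inj] at h2
    have h3 := hgoals Finset.univ i
    have h4 := hgoals Finset.univ j
    have h5 := hle1 Finset.univ i
    omega
  · have h1 := hS.2 i hi j hj hij
    have h2 := hTg' i hi j hj
    rw [goals_toReal, goals_toReal, Nat.cast_inj] at h2
    have h3 := hgoals (nonLeaders n) i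
    have h4 := hgoals (nonLeaders n) j
    have h5 := hle1 (nonLeaders n) i
    omega

theorem toReal_add (S T : Pos n → ℕ) : toReal (S + T) = toReal S + toReal T := by
  ext e; simp [toReal]

theorem leaderGoals_add (x y : Pos n → ℝ) :
    leaderGoals (x + y) = leaderGoals x + leaderGoals y := by
  simp [leaderGoals, Finset.sum_add_distrib]

/-- A runner-up consistent score sheet with `c` goals of the leader team is a sum of `c` sheets with
one such goal. -/
theorem exists_sum_leaderSheets (hn : 2 ≤ n) (c : ℕ) {S : Pos n → ℕ}
    (hS : S ∈ runnerUpConsistent n) (hc : leaderGoals (toReal S) = c) :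
    ∃ x : Fin c → (Pos n → ℝ), (∀ k, x k ∈ leaderSheets n) ∧ toReal S = ∑ k, x k := by
  induction c generalizing S with
  | zero =>
    refine ⟨Fin.elim0, fun k => k.elim0, ?_⟩
    ext e
    have hx := isRunnerUpVector_toReal.2 hS
    have h1 := hx.le_leaderGoals e
    rw [hc, Nat.cast_zero] at h1
    simpa using le_antisymm h1 (hx.nonneg e)
  | succ c ih =>
    have hS0 : S ≠ 0 := by
      rintro rfl
      have : leaderGoals (toReal (0 : Pos n → ℕ)) = 0 := by simp [leaderGoals, toReal]
      rw [this] at hc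
      exact absurd hc.symm (Nat.cast_ne_zero.2 c.succ_ne_zero)
    obtain ⟨T, hT, hT1, U, hU, rfl⟩ := exists_eq_add_of_ne_zero hn hS hS0
    rw [toReal_add, leaderGoals_add, hT1, Nat.cast_add_one, add_comm] at hc
    obtain ⟨x, hx, hxU⟩ := ih hU (add_right_cancel hc)
    refine ⟨Fin.cons (toReal T) x, fun k => ?_, ?_⟩
    · refine Fin.cases ?_ (fun k => ?_) k
      · exact ⟨T, ⟨hT, hT1⟩, rfl⟩
      · exact hx k
    · rw [Fin.sum_univ_succ, toReal_add, hxU]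
      simp

theorem leaderSheets_subset_runnerUpPolytope : leaderSheets n ⊆ runnerUpPolytope n := by
  rintro _ ⟨S, ⟨hS, h1⟩, rfl⟩
  exact ⟨PointedCone.subset_hull ⟨S, hS, rfl⟩, h1⟩

theorem toReal_hilbertBasis_subset (hn : 2 ≤ n) :
    toReal '' hilbertBasis (runnerUpConsistent n) ⊆ runnerUpPolytope n := by
  rintro _ ⟨S, ⟨hS, hirr⟩, rfl⟩
  have hS0 : S ≠ 0 := by
    rintro rfl
    exact hirr.ne_zero rfl
  obtain ⟨T, hT, hT1, U, hU, hTU⟩ := exists_eq_add_of_ne_zero hn hS hS0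
  -- the only unit of the monoid is zero, as the entries are natural numbers
  have hunit : ∀ V : runnerUpConsistent n, IsAddUnit V → (V : Pos n → ℕ) = 0 := by
    intro V hV
    obtain ⟨W, hW⟩ := hV.exists_neg
    have h1 : (V : Pos n → ℕ) + W = 0 := congrArg Subtype.val hW
    ext e
    have := congrFun h1 e
    simp only [Pi.add_apply, Pi.zero_apply] at this ⊢
    omega
  rcases hirr.isAddUnit_or_isAddUnit (a := ⟨T, hT⟩) (b := ⟨U, hU⟩) (Subtype.ext hTU) with h | h
  · have h0 : T = 0 := hunit _ h
    rw [h0] at hT1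
    simp [leaderGoals, toReal] at hT1
  · have h0 : U = 0 := hunit _ h
    rw [h0, add_zero] at hTU
    rw [hTU]
    exact leaderSheets_subset_runnerUpPolytope ⟨T, ⟨hT, hT1⟩, rfl⟩

theorem isIntegrallyClosedPolytope_runnerUpPolytope (hn : 2 ≤ n) :
    IsIntegrallyClosedPolytope (runnerUpPolytope n) := by
  refine ⟨⟨leaderSheets n, finite_leaderSheets, leaderSheets_subset_latticePoints, ?_⟩, ?_⟩
  · rw [runnerUpPolytope_eq_polyhedron hn, polyhedron_sheetForm_eq_convexHull hn]
  rintro c - _ ⟨a, rfl⟩ ⟨y, hy, hya⟩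
  replace hya : (c : ℝ) • y = fun e => (a e : ℝ) := hya
  change ∃ x : Fin c → (Pos n → ℝ), _ ∧ (fun e => (a e : ℝ)) = _
  have hz : IsRunnerUpVector (fun e => (a e : ℝ)) := by
    rw [← hya]
    exact (isRunnerUpVector_of_mem_runnerUpCone hy.1).smul c.cast_nonneg
  have hS : toReal (fun e => (a e).toNat) = fun e => (a e : ℝ) := by
    ext e
    have h0 : 0 ≤ a e := by exact_mod_cast hz.nonneg e
    change (((a e).toNat : ℕ) : ℝ) = (a e : ℝ)
    rw [← Int.cast_natCast, Int.toNat_of_nonneg h0]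
  rw [← hS] at hz hya ⊢
  have hc : leaderGoals (toReal (fun e => (a e).toNat)) = c := by
    rw [← hya]
    have : leaderGoals ((c : ℝ) • y) = c * leaderGoals y := by
      simp [leaderGoals, Finset.mul_sum]
    rw [this, hy.2, mul_one]
  obtain ⟨x, hx, hsum⟩ := exists_sum_leaderSheets hn c (isRunnerUpVector_toReal.1 hz) hc
  exact ⟨x, fun k => ⟨leaderSheets_subset_runnerUpPolytope (hx k),
    leaderSheets_subset_latticePoints (hx k)⟩, hsum⟩

end Sheets
end ScoreSheets

theorem mainTheorem4 (n : ℕ) (hn : 3 ≤ n) :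
    (∀ (N : ℕ) (p : Fin N → (ScoreSheets.Pos n → ℝ)),
      ScoreSheets.IsPullingOrder (ScoreSheets.runnerUpPolytope n) p →
        ScoreSheets.IsUnimodularTriangulation (ScoreSheets.runnerUpPolytope n)
          (ScoreSheets.pullingTriangulation p (ScoreSheets.runnerUpPolytope n))) ∧
    ScoreSheets.toReal '' ScoreSheets.hilbertBasis (ScoreSheets.runnerUpConsistent n) ⊆
      ScoreSheets.runnerUpPolytope n ∧
    ScoreSheets.IsIntegrallyClosedPolytope (ScoreSheets.runnerUpPolytope n) := by
  have hn2 : 2 ≤ n := by omega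
  refine ⟨fun N p hp => ?_, ScoreSheets.toReal_hilbertBasis_subset hn2,
    ScoreSheets.isIntegrallyClosedPolytope_runnerUpPolytope hn2⟩
  rw [ScoreSheets.runnerUpPolytope_eq_polyhedron hn2] at hp ⊢
  exact ScoreSheets.isUnimodularTriangulation_pullingTriangulation
    (fun k _ hz => ScoreSheets.sheetForm_integral k hz)
    (fun k _ hx => ScoreSheets.sheetForm_le k hx) hp
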